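/- **Setting.** Let $G$ be a second countable, locally compact, unimodular (Hausdorff) group with Haar measure $\mu$ and identity $e$. Assume that $G$ has polynomial growth with exponent $D>0$: $G$ is generated by a compact symmetric unit neighborhood $U$ with $\mu(U^n)\le C n^D$ for all $n\ge 1$ and some $C\ge 1$. Let $d$ be a *periodic metric* on $G$, that is, a measurable metric $d:G\times G\to[0,\infty)$ (not required to induce the topology) such that: $d(zx,zy)=d(x,y)$; for every $r$ the set $\{y: d(e,y)\le r\}$ is relatively compact; $d$ is bounded on compact subsets of $G\times G$; and for every $\varepsilon>0$ there is $s>0$ such that any $x,y\in G$ can be joined by points $x=x_1,\dots,x_n=y$ with $\sum_i d(x_i,x_{i+1})\le(1+\varepsilon)d(x,y)$ and $d(x_i,x_{i+1})\le s$ for all $i$. Write $|x|=d(x,e)$ and $B_r=\{x:|x|<r\}$. Assume that $d$ has the $\delta$-annular decay property for some $\delta\in(0,1]$: there is $c>0$ with $$\mu(B_r\setminus B_{r-s})\le c\,(s/r)^\delta\mu(B_r)\qquad\text{for all } r\ge 1,\ 0<s\le r.$$ Let $(\pi,\mathcal H_\pi)$ be a projective discrete series representation of $G$ on a separable complex Hilbert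 space: $\pi$ is a strongly measurable map into the unitary operators with $\pi(x)\pi(y)=\sigma(x,y)\pi(xy)$, $|\sigma(x,y)|=1$, it is irreducible, and $\int_G|\langle h,\pi(x)h\rangle|^2d\mu(x)<\infty$ for some $h\ne0$. Its formal degree is the unique $d_\pi>0$ with $$\int_G \langle f_1,\pi(x)g_1\rangle\langle \pi(x)g_2,f_2\rangle\,d\mu(x)=d_\pi^{-1}\langle f_1,f_2\rangle\overline{\langle g_1,g_2\rangle}\qquad\text{for all } f_1,f_2,g_1,g_2\in\mathcal H_\pi.$$ Let $\alpha>0$. A vector $g\in\mathcal H_\pi$ belongs to $\mathcal D_{\pi,w_\alpha}$ if, for a relatively compact symmetric unit neighborhood $Q$, $$\int_G \sup_{z\in Q}|\langle g,\pi(xz)g\rangle|^2\,(1+|x|)^\alpha\,d\mu(x)<\infty .$$ A sequence of radii $r_n>0$ is called *associated to $d$* if there is $r_0>0$ such that $B_{r_0}$ is a unit neighborhood and $r_{n+1}-r_n>r_0$ for all $n$; $\overline{B_{r_n}}$ denotes the closure of $B_{r_n}$ in $G$. For $\Lambda\subseteq G$, the family $\pi(\Lambda)g=(\pi(\lambda)g)_{\lambda\in\Lambda}$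 is a *frame* with bounds $A,B>0$ if $A\|f\|^2\le\sum_{\lambda\in\Lambda}|\langle f,\pi(\lambda)g\rangle|^2\le B\|f\|^2$ for all $f\in\mathcal H_\pi$, and a *Riesz sequence* with bounds $A,B>0$ if $A\|c\|^2\le\|\sum_{\lambda\in\Lambda}c_\lambda\pi(\lambda)g\|^2\le B\|c\|^2$ for all $c\in\ell^2(\Lambda)$. **Theorem.** Let $g\in\mathcal H_\pi$. (0) If there are $C_0>0$ and $\beta>1-\delta$ with $|\langle g,\pi(x)g\rangle|\le C_0(1+|x|)^{-(D+\alpha+\beta)/2}$ for all $x\in G$, then $g\in\mathcal D_{\pi,w_\alpha}$ (with any choice of $Q$). Suppose that $g\in\mathcal D_{\pi,w_\alpha}$ (with some choice of $Q$), and let $A,B>0$. (i) There is $C>0$, depending only on $g,\alpha,d,A,B$ (and the fixed $G,\mu,\pi$), such that for every sequence $(r_n)$ associated to $d$ there is $N$ such that, whenever $\Lambda\subseteq G$ and $\pi(\Lambda)g$ is a frame with bounds $A,B$, $$\inf_{x\in G}\frac{\#(\Lambda\cap x\overline{B_{r_n}})}{\mu(\overline{B_{r_n}})}\ \ge\ d_\pi\Big(1-C\,r_n^{-\frac{\alpha\delta}{\delta+\alpha}}\Big)\qquad\text{for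 all } n\ge N.$$ (ii) There is $C>0$, depending only on $g,\alpha,d,A,B$ (and the fixed $G,\mu,\pi$), such that for every sequence $(r_n)$ associated to $d$ there is $N$ such that, whenever $\Lambda\subseteq G$ and $\pi(\Lambda)g$ is a Riesz sequence with bounds $A,B$, $$\sup_{x\in G}\frac{\#(\Lambda\cap x\overline{B_{r_n}})}{\mu(\overline{B_{r_n}})}\ \le\ d_\pi\Big(1+C\,r_n^{-\frac{\alpha\delta}{\delta+\alpha}}\Big)\qquad\text{for all } n\ge N.$$ -/

import Mathlib

open MeasureTheory Topology
open scoped Pointwise ENNReal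

namespace CoherentSystem

noncomputable section

/-! ### Projective representations, discrete series and the formal degree -/

/-- A projective unitary representation of `G` on `H`: a strongly measurable map `x ↦ π x` into the
unitary operators of `H` with `π x (π y v) = σ x y • π (x * y) v` for a cocycle `σ : G × G → 𝕋`. -/
structure ProjectiveRep (G : Type*) [Group G] [TopologicalSpace G] [MeasurableSpace G]
    (H : Type*) [NormedAddCommGroup H] [InnerProductSpace ℂ H] where
  /-- the unitary operator attached to a group element -/
  op : G → (H ≃ₗᵢ[ℂ] H)
  /-- the cocycle -/
  σ : G → G → Circle
  op_mul : ∀ (x y : G) (v : H), op x (op y v) = (σ x y : ℂ) • op (x * y) v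
  stronglyMeasurable_op : ∀ v : H, StronglyMeasurable fun x => op x v

section Representation

variable {G : Type*} [Group G] [TopologicalSpace G] [MeasurableSpace G]
  {H : Type*} [NormedAddCommGroup H] [InnerProductSpace ℂ H]

/-- The coefficient transform `V_g f (x) = ⟨f, π(x) g⟩`, where the inner product `⟨·,·⟩` is linear in
its first entry (`inner ℂ` is linear in its second entry). -/
def coeff (π : ProjectiveRep G H) (g f : H) (x : G) : ℂ :=
  inner ℂ (π.op x g) f

/-- The only closed invariant subspaces are `{0}` and the whole space. -/
def IsIrreducible (π : ProjectiveRep G H) : Prop :=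
  ∀ W : Submodule ℂ H, IsClosed (W : Set H) →
    (∀ x : G, ∀ v ∈ W, π.op x v ∈ W) → W = ⊥ ∨ W = ⊤

/-- A projective discrete series representation: irreducible and square-integrable. -/
def IsDiscreteSeries (π : ProjectiveRep G H) (μ : Measure G) : Prop :=
  IsIrreducible π ∧ ∃ g : H, g ≠ 0 ∧ Integrable (fun x => ‖coeff π g g x‖ ^ 2) μ

/-- The orthogonality relations with constant `dπ > 0`:
`∫ ⟨f₁, π(x) g₁⟩ ⟨π(x) g₂, f₂⟩ dμ(x) = dπ⁻¹ ⟨f₁, f₂⟩ conj ⟨g₁, g₂⟩`. -/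
def IsFormalDegree (π : ProjectiveRep G H) (μ : Measure G) (dπ : ℝ) : Prop :=
  0 < dπ ∧ ∀ f₁ f₂ g₁ g₂ : H,
    ∫ x, coeff π g₁ f₁ x * star (coeff π g₂ f₂ x) ∂μ
      = ((dπ : ℂ))⁻¹ * inner ℂ f₂ f₁ * star (inner ℂ g₂ g₁)

open Classical in
/-- The formal degree of `π`: the number `dπ > 0` for which the orthogonality relations hold.
Every projective discrete series representation of a unimodular group has exactly one; the value `0`
is only assigned to representations that have none. -/
def formalDegree (π : ProjectiveRep G H) (μ : Measure G) : ℝ :=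
  if h : ∃ dπ : ℝ, IsFormalDegree π μ dπ then h.choose else 0

/-- `π(Λ) g`, a family indexed by `Λ`, is a frame for `H` with frame bounds `A` and `B`. -/
def IsFrame (π : ProjectiveRep G H) (g : H) (Λ : Set G) (A B : ℝ) : Prop :=
  ∀ f : H, Summable (fun l : Λ => ‖coeff π g f (l : G)‖ ^ 2) ∧
    A * ‖f‖ ^ 2 ≤ ∑' l : Λ, ‖coeff π g f (l : G)‖ ^ 2 ∧
    ∑' l : Λ, ‖coeff π g f (l : G)‖ ^ 2 ≤ B * ‖f‖ ^ 2

/-- `π(Λ) g`, a family indexed by `Λ`, is a Riesz sequence in `H` with Riesz bounds `A` and `B`. -/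
def IsRieszSequence (π : ProjectiveRep G H) (g : H) (Λ : Set G) (A B : ℝ) : Prop :=
  ∀ c : lp (fun _ : Λ => ℂ) 2, Summable (fun l : Λ => c l • π.op (l : G) g) ∧
    A * ‖c‖ ^ 2 ≤ ‖∑' l : Λ, c l • π.op (l : G) g‖ ^ 2 ∧
    ‖∑' l : Λ, c l • π.op (l : G) g‖ ^ 2 ≤ B * ‖c‖ ^ 2

/-- `Q` is a relatively compact symmetric unit neighborhood. -/
def IsAdmissibleNhd (Q : Set G) : Prop :=
  Q ∈ 𝓝 (1 : G) ∧ IsCompact (closure Q) ∧ Q⁻¹ = Q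

/-- The local maximal function `M_Q F (x) = sup_{z ∈ Q} |F (x z)|`. -/
def localMax (Q : Set G) (F : G → ℂ) (x : G) : ℝ≥0∞ :=
  ⨆ z ∈ Q, ‖F (x * z)‖ₑ

/-- The set `𝓓_{π,w}` of vectors `g` with `M_Q V_g g ∈ L²_w(G)`, for a weight `w ≥ 1`, where the
local maximal function is formed with the unit neighborhood `Q`. -/
def localizedVectors (π : ProjectiveRep G H) (μ : Measure G) (Q : Set G) (w : G → ℝ) : Set H :=
  {g | ∫⁻ x, localMax Q (coeff π g g) x ^ 2 * ENNReal.ofReal (w x) ∂μ < ⊤}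

end Representation

/-! ### Polynomial growth and periodic metrics -/

section Metric

variable {G : Type*} [Group G] [TopologicalSpace G] [MeasurableSpace G]

/-- `G` is generated by a compact symmetric unit neighborhood `U` with `μ(Uⁿ) ≤ C n^D` for all
`n ≥ 1`. -/
def HasPolynomialGrowth (μ : Measure G) (D : ℝ) : Prop :=
  0 < D ∧ ∃ U : Set G, IsCompact U ∧ U ∈ 𝓝 (1 : G) ∧ U⁻¹ = U ∧ Subgroup.closure U = ⊤ ∧
    ∃ C : ℝ, 1 ≤ C ∧ ∀ n : ℕ, 1 ≤ n → μ (U ^ n) ≤ ENNReal.ofReal (C * (n : ℝ) ^ D)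

/-- A periodic metric on `G`: a measurable metric (not required to induce the topology) which is
left-invariant, metrically proper, locally bounded and asymptotically geodesic. -/
structure IsPeriodicMetric (d : G → G → ℝ) : Prop where
  nonneg : ∀ x y, 0 ≤ d x y
  eq_zero_iff : ∀ x y, d x y = 0 ↔ x = y
  symm : ∀ x y, d x y = d y x
  triangle : ∀ x y z, d x z ≤ d x y + d y z
  measurable : Measurable fun p : G × G => d p.1 p.2
  left_invariant : ∀ x y z, d (z * x) (z * y) = d x y
  /-- preimages of bounded sets under `y ↦ d e y` are relatively compact -/
  proper : ∀ r : ℝ, IsCompact (closure {y : G | d 1 y ≤ r})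
  locally_bounded : ∀ K : Set (G × G), IsCompact K → BddAbove ((fun p : G × G => d p.1 p.2) '' K)
  asymptotically_geodesic : ∀ ε : ℝ, 0 < ε → ∃ s : ℝ, 0 < s ∧ ∀ x y : G,
    ∃ (n : ℕ) (p : ℕ → G), p 0 = x ∧ p n = y ∧
      ∑ i ∈ Finset.range n, d (p i) (p (i + 1)) ≤ (1 + ε) * d x y ∧
      ∀ i < n, d (p i) (p (i + 1)) ≤ s

/-- The open ball `B_r = {x | d x e < r}`. -/
def oball (d : G → G → ℝ) (r : ℝ) : Set G :=
  {x | d x 1 < r}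

/-- The `δ`-annular decay property. -/
def AnnularDecay (μ : Measure G) (d : G → G → ℝ) (δ : ℝ) : Prop :=
  0 < δ ∧ δ ≤ 1 ∧ ∃ c : ℝ, 0 < c ∧ ∀ r s : ℝ, 1 ≤ r → 0 < s → s ≤ r →
    μ (oball d r \ oball d (r - s)) ≤ ENNReal.ofReal (c * (s / r) ^ δ) * μ (oball d r)

/-- The radii `r n > 0` of a strong Følner exhaustion sequence `closure (B_{r n})` associated to `d`:
consecutive radii differ by more than some `r₀ > 0` for which `B_{r₀}` is a unit neighborhood. -/
def IsAssociatedRadii (d : G → G → ℝ) (r : ℕ → ℝ) : Prop :=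
  (∀ n, 0 < r n) ∧ ∃ r₀ : ℝ, 0 < r₀ ∧ oball d r₀ ∈ 𝓝 (1 : G) ∧ ∀ n, r₀ < r (n + 1) - r n

/-- The polynomial weight `w_α (x) = (1 + |x|)^α`, where `|x| = d x e`. -/
def polyWeight (d : G → G → ℝ) (α : ℝ) (x : G) : ℝ :=
  (1 + d x 1) ^ α

/-- The ratio `#(Λ ∩ xK) / μ(K)`. -/
def countingRatio (μ : Measure G) (Λ K : Set G) (x : G) : ℝ≥0∞ :=
  ((Λ ∩ x • K).encard : ℝ≥0∞) / μ K

end Metric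

end

end CoherentSystem

/-!
The orthogonality relations give, for every finite-dimensional subspace `W` of `H`,
`∫ ‖P_W (π(x) g)‖² dμ(x) = d_π⁻¹ ‖g‖² dim W`, where `P_W` is the orthogonal projection onto `W`.

For a frame, take for `W` the span of the dual frame elements indexed by `Λ ∩ x B_r`. It has
dimension at most `#(Λ ∩ x B_r)`, and it almost contains `π(y) g` for `y ∈ x B_{r-s}`, because by
localization the coefficients of `π(y) g` at distance more than `s` from `y` have square sum
`O(s^{-α})`. For a Riesz sequence, take for `W` the span of the elements indexed by `Λ ∩ x B_r`. It
has dimension exactly `#(Λ ∩ x B_r)`, and the integral over the complement of `x B_{r+s}` is only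
`O(s^{-α} dim W)`. Either way the counting function is compared with the volume of a ball of radius
`r ± s` up to a relative error `O(s^{-α})`, while annular decay compares that volume with the volume
of `B_r` up to a relative error `O((s/r)^δ)`. The choice `s = r^{δ/(δ+α)}` balances the two errors.
-/

namespace CoherentSystem

open Filter

/-! ### Matrix coefficients -/

section Coefficients

variable {G : Type*} [Group G] [TopologicalSpace G] [MeasurableSpace G]
  {H : Type*} [NormedAddCommGroup H] [InnerProductSpace ℂ H]

lemma ProjectiveRep.op_one (π : ProjectiveRep G H) (v : H) :
    π.op 1 v = (π.σ 1 1 : ℂ) • v := by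
  have h := π.op_mul 1 1 v
  rw [mul_one, ← map_smul] at h
  exact (π.op 1).injective h

lemma coeff_op_right (π : ProjectiveRep G H) (h f : H) (x y : G) :
    coeff π h (π.op y f) x = (π.σ y (y⁻¹ * x) : ℂ) * coeff π h f (y⁻¹ * x) := by
  have hmul := π.op_mul y (y⁻¹ * x) h
  rw [mul_inv_cancel_left] at hmul
  have hop : π.op x h = ((π.σ y (y⁻¹ * x))⁻¹ : Circle) • π.op y (π.op (y⁻¹ * x) h) := by
    rw [hmul, ← Circle.smul_def, smul_smul, inv_mul_cancel, one_smul]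
  rw [coeff, hop, Circle.smul_def, inner_smul_left, LinearIsometryEquiv.inner_map_map,
    ← Circle.coe_inv_eq_conj, inv_inv, coeff]

lemma norm_coeff_op_right (π : ProjectiveRep G H) (h f : H) (x y : G) :
    ‖coeff π h (π.op y f) x‖ = ‖coeff π h f (y⁻¹ * x)‖ := by
  rw [coeff_op_right, norm_mul, Circle.norm_coe, one_mul]

lemma norm_coeff_swap (π : ProjectiveRep G H) (h f : H) (x : G) :
    ‖coeff π f h x‖ = ‖coeff π h f x⁻¹‖ := by
  have hmul := π.op_mul x x⁻¹ h
  rw [mul_inv_cancel, π.op_one, smul_smul] at hmul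
  calc ‖coeff π f h x‖ = ‖inner ℂ (π.op x f) (π.op x (π.op x⁻¹ h))‖ := by
        rw [hmul, inner_smul_right, norm_mul, norm_mul, Circle.norm_coe, Circle.norm_coe, one_mul,
          one_mul, coeff]
    _ = ‖coeff π h f x⁻¹‖ := by rw [LinearIsometryEquiv.inner_map_map, norm_inner_symm, coeff]

lemma coeff_add_right (π : ProjectiveRep G H) (g f f' : H) :
    coeff π g (f + f') = coeff π g f + coeff π g f' :=
  funext fun _ => inner_add_right _ _ _

lemma coeff_smul_right (π : ProjectiveRep G H) (g f : H) (c : ℂ) :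
    coeff π g (c • f) = c • coeff π g f :=
  funext fun _ => inner_smul_right _ _ _

lemma coeff_add_left (π : ProjectiveRep G H) (g g' f : H) :
    coeff π (g + g') f = coeff π g f + coeff π g' f := by
  funext x
  rw [coeff, map_add, inner_add_left]
  rfl

lemma coeff_smul_left (π : ProjectiveRep G H) (g f : H) (c : ℂ) :
    coeff π (c • g) f = star c • coeff π g f := by
  funext x
  rw [coeff, map_smul, inner_smul_left]
  rfl

lemma stronglyMeasurable_coeff (π : ProjectiveRep G H) (g f : H) :
    StronglyMeasurable (coeff π g f) :=
  (π.stronglyMeasurable_op g).inner stronglyMeasurable_const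

end Coefficients

/-! ### Schur's lemma -/

section Schur

variable {G : Type*} [Group G] [TopologicalSpace G] [MeasurableSpace G]
  {H : Type*} [NormedAddCommGroup H] [InnerProductSpace ℂ H] {π : ProjectiveRep G H}

lemma IsIrreducible.eq_zero_or_eq_zero_of_mul_eq_zero (hπ : IsIrreducible π) {S R : H →L[ℂ] H}
    (hS : ∀ x v, S (π.op x v) = π.op x (S v)) (hSR : S * R = 0) : S = 0 ∨ R = 0 := by
  have hker : ∀ x, ∀ v ∈ S.ker, π.op x v ∈ S.ker := fun x v hv => by
    have hv : S v = 0 := hv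
    change S (π.op x v) = 0
    rw [hS, hv, map_zero]
  rcases hπ S.ker S.isClosed_ker hker with h | h
  · refine .inr (ContinuousLinearMap.ext fun v => ?_)
    have hRv : R v ∈ S.ker := DFunLike.congr_fun hSR v
    rwa [h] at hRv
  · exact .inl (ContinuousLinearMap.ext fun v => (h ▸ Submodule.mem_top : v ∈ S.ker))

variable [CompleteSpace H] {T : H →L[ℂ] H}

lemma cfc_apply_op (hT : ∀ x v, T (π.op x v) = π.op x (T v)) (f : ℝ → ℝ) (x : G) (v : H) :
    cfc f T (π.op x v) = π.op x (cfc f T v) := by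
  have hcomm : Commute T ((π.op x).toContinuousLinearEquiv : H →L[ℂ] H) :=
    ContinuousLinearMap.ext (hT x)
  exact DFunLike.congr_fun (hcomm.cfc_real f).eq v

lemma IsIrreducible.subsingleton_spectrum (hπ : IsIrreducible π) (hsa : IsSelfAdjoint T)
    (hT : ∀ x v, T (π.op x v) = π.op x (T v)) : (spectrum ℝ T).Subsingleton := by
  intro a ha b hb
  by_contra! hne
  wlog hab : a < b generalizing a b
  · exact this hb ha hne.symm (hne.lt_or_gt.resolve_left hab)
  have : Nontrivial H := by
    by_contra! hH
    simp [spectrum.of_subsingleton] at ha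
  have cfc_ne_zero : ∀ {f : ℝ → ℝ} {t : ℝ}, Continuous f → t ∈ spectrum ℝ T → f t ≠ 0 →
      cfc f T ≠ 0 := by
    intro f t hf ht hft h0
    have hmem : f t ∈ spectrum ℝ (cfc f T) := by
      rw [cfc_map_spectrum f T (hf := hf.continuousOn)]
      exact ⟨t, ht, rfl⟩
    rw [h0, spectrum.zero_eq] at hmem
    exact hft hmem
  -- two bumps with disjoint supports, nonzero at `a` and at `b` respectively
  let f : ℝ → ℝ := fun t => max ((a + b) / 2 - t) 0
  let g : ℝ → ℝ := fun t => max (t - (a + b) / 2) 0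
  have hf : Continuous f := by fun_prop
  have hg : Continuous g := by fun_prop
  have hfg : cfc f T * cfc g T = 0 := by
    rw [← cfc_mul f g T hf.continuousOn hg.continuousOn, ← cfc_const_zero ℝ T]
    congr 1
    funext t
    rcases le_total t ((a + b) / 2) with h | h <;> simp [f, g, h]
  have hfa : f a ≠ 0 := (lt_max_of_lt_left (by linarith)).ne'
  have hgb : g b ≠ 0 := (lt_max_of_lt_left (by linarith)).ne'
  exact (hπ.eq_zero_or_eq_zero_of_mul_eq_zero (cfc_apply_op hT f) hfg).elim
    (cfc_ne_zero hf ha hfa) (cfc_ne_zero hg hb hgb)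

theorem IsIrreducible.exists_eq_smul_of_isSelfAdjoint (hπ : IsIrreducible π)
    (hsa : IsSelfAdjoint T) (hT : ∀ x v, T (π.op x v) = π.op x (T v)) :
    ∃ c : ℝ, ∀ v, T v = (c : ℂ) • v := by
  nontriviality H
  obtain ⟨c, hc⟩ := ContinuousFunctionalCalculus.spectrum_nonempty (R := ℝ) T hsa
  refine ⟨c, fun v => ?_⟩
  have hcfc : cfc (id : ℝ → ℝ) T = cfc (fun _ => c) T :=
    cfc_congr fun b hb => hπ.subsingleton_spectrum hsa hT hb hc
  rw [cfc_id ℝ T, cfc_const c T, Algebra.algebraMap_eq_smul_one] at hcfc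
  conv_lhs => rw [hcfc]
  simp

end Schur

/-! ### Square-integrable coefficients -/

section CoefficientGraph

variable {G : Type*} [Group G] [TopologicalSpace G] [MeasurableSpace G] {μ : Measure G}
  {H : Type*} [NormedAddCommGroup H] [InnerProductSpace ℂ H] {π : ProjectiveRep G H} {h f : H}

/-- The graph of the (a priori unbounded and not everywhere defined) coefficient transform
`f ↦ V_h f` from `H` to `L²(G)`, as a subspace of the Hilbert sum. -/
def coeffGraph (π : ProjectiveRep G H) (μ : Measure G) (h : H) :
    Submodule ℂ (WithLp 2 (H × Lp ℂ 2 μ)) where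
  carrier := {p | p.snd =ᵐ[μ] coeff π h p.fst}
  zero_mem' := by
    filter_upwards [Lp.coeFn_zero ℂ 2 μ] with x hx
    simpa [coeff] using hx
  add_mem' {p q} hp hq := (Lp.coeFn_add p.snd q.snd).trans
    ((EventuallyEq.add hp.out hq.out).trans (coeff_add_right π h p.fst q.fst).symm.eventuallyEq)
  smul_mem' c p hp := (Lp.coeFn_smul c p.snd).trans
    ((EventuallyEq.const_smul hp.out c).trans (coeff_smul_right π h p.fst c).symm.eventuallyEq)

lemma mem_coeffGraph {p : WithLp 2 (H × Lp ℂ 2 μ)} :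
    p ∈ coeffGraph π μ h ↔ p.snd =ᵐ[μ] coeff π h p.fst := Iff.rfl

lemma isClosed_coeffGraph (π : ProjectiveRep G H) (μ : Measure G) (h : H) :
    IsClosed (coeffGraph π μ h : Set (WithLp 2 (H × Lp ℂ 2 μ))) := by
  refine isClosed_of_closure_subset fun p hp => ?_
  obtain ⟨u, hu, hlim⟩ := mem_closure_iff_seq_limit.1 hp
  have hfst : Tendsto (fun n => (u n).fst) atTop (𝓝 p.fst) :=
    ((WithLp.prod_continuous_ofLp 2 H (Lp ℂ 2 μ)).fst.tendsto p).comp hlim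
  have hsnd : Tendsto (fun n => (u n).snd) atTop (𝓝 p.snd) :=
    ((WithLp.prod_continuous_ofLp 2 H (Lp ℂ 2 μ)).snd.tendsto p).comp hlim
  obtain ⟨φ, hφ, hae⟩ := (tendstoInMeasure_of_tendsto_Lp hsnd).exists_seq_tendsto_ae
  have hgraph : ∀ᵐ x ∂μ, ∀ n, (u n).snd x = coeff π h (u n).fst x :=
    ae_all_iff.2 fun n => hu n
  refine mem_coeffGraph.2 ?_
  filter_upwards [hae, hgraph] with x hlim_x hgraph_x
  simp only [hgraph_x] at hlim_x
  exact tendsto_nhds_unique hlim_x (tendsto_const_nhds.inner (hfst.comp hφ.tendsto_atTop))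

lemma memLp_of_mem_coeffGraph (p : coeffGraph π μ h) : MemLp (coeff π h p.1.fst) 2 μ :=
  (memLp_congr_ae (mem_coeffGraph.1 p.2)).1 (Lp.memLp p.1.snd)

/-- The point of the graph of `V_h` above a vector `f` with square-integrable `V_h f`. -/
noncomputable def graphElt (hf : MemLp (coeff π h f) 2 μ) : coeffGraph π μ h :=
  ⟨WithLp.toLp 2 (f, hf.toLp), hf.coeFn_toLp⟩

/-- The projection `(f, V_h f) ↦ f` of the graph of `V_h` onto the domain of `V_h`. -/
noncomputable def graphFst (π : ProjectiveRep G H) (μ : Measure G) (h : H) :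
    coeffGraph π μ h →L[ℂ] H :=
  WithLp.fstL 2 ℂ H (Lp ℂ 2 μ) ∘L (coeffGraph π μ h).subtypeL

lemma memLp_coeff_graphFst (p : coeffGraph π μ h) : MemLp (coeff π h (graphFst π μ h p)) 2 μ :=
  memLp_of_mem_coeffGraph p

lemma graphFst_apply (p : coeffGraph π μ h) : graphFst π μ h p = p.1.fst := rfl

@[simp]
lemma graphFst_graphElt (hf : MemLp (coeff π h f) 2 μ) : graphFst π μ h (graphElt hf) = f := rfl

lemma inner_coeffGraph (p q : coeffGraph π μ h) :
    inner ℂ p q = inner ℂ (graphFst π μ h p) (graphFst π μ h q)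
      + ∫ x, inner ℂ (coeff π h (graphFst π μ h p) x) (coeff π h (graphFst π μ h q) x) ∂μ := by
  rw [Submodule.coe_inner, WithLp.prod_inner_apply, L2.inner_def, graphFst_apply, graphFst_apply]
  congr 1
  refine integral_congr_ae ?_
  filter_upwards [mem_coeffGraph.1 p.2, mem_coeffGraph.1 q.2] with x hp hq
  exact congrArg₂ _ hp hq

variable [IsTopologicalGroup G] [BorelSpace G] [μ.IsMulLeftInvariant]

lemma memLp_coeff_op_iff (y : G) :
    MemLp (coeff π h (π.op y f)) 2 μ ↔ MemLp (coeff π h f) 2 μ := by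
  have hmeas := (stronglyMeasurable_coeff π h f).comp_measurable (measurable_const_mul y⁻¹)
  rw [memLp_congr_norm (stronglyMeasurable_coeff π _ _).aestronglyMeasurable
    hmeas.aestronglyMeasurable (.of_forall fun x => norm_coeff_op_right π h f x y)]
  conv_rhs => rw [← map_mul_left_eq_self μ y⁻¹, memLp_map_measure_iff
    (stronglyMeasurable_coeff π h f).aestronglyMeasurable (measurable_const_mul y⁻¹).aemeasurable]

lemma integral_inner_coeff_op (f' : H) (y : G) :
    ∫ x, inner ℂ (coeff π h (π.op y f) x) (coeff π h (π.op y f') x) ∂μ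
      = ∫ x, inner ℂ (coeff π h f x) (coeff π h f' x) ∂μ := by
  rw [← integral_mul_left_eq_self (μ := μ)
    (fun x => (inner ℂ (coeff π h f x) (coeff π h f' x) : ℂ)) y⁻¹]
  congr 1 with x
  have hphase : ∀ z : Circle, (starRingEnd ℂ) (z : ℂ) * z = 1 := fun z => by
    rw [← Circle.coe_inv_eq_conj, ← Circle.coe_mul, inv_mul_cancel, Circle.coe_one]
  simp only [coeff_op_right, RCLike.inner_apply, map_mul]
  linear_combination (coeff π h f' (y⁻¹ * x) * (starRingEnd ℂ) (coeff π h f (y⁻¹ * x)))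
    * hphase (π.σ y (y⁻¹ * x))

lemma inner_graphElt_op (p q : coeffGraph π μ h) {y : G} (hf : MemLp (coeff π h f) 2 μ)
    (hq : graphFst π μ h q = π.op y f) :
    inner ℂ (graphElt ((memLp_coeff_op_iff y).2 (memLp_coeff_graphFst p))) q
      = inner ℂ p (graphElt hf) := by
  rw [inner_coeffGraph, inner_coeffGraph, graphFst_graphElt, graphFst_graphElt, hq,
    integral_inner_coeff_op, LinearIsometryEquiv.inner_map_map]

variable [CompleteSpace H]

instance : CompleteSpace (coeffGraph π μ h) :=
  (isClosed_coeffGraph π μ h).completeSpace_coe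

lemma adjoint_graphFst_op (y : G) (u : H) :
    graphFst π μ h ((graphFst π μ h).adjoint (π.op y u))
      = π.op y (graphFst π μ h ((graphFst π μ h).adjoint u)) := by
  suffices (graphFst π μ h).adjoint (π.op y u)
      = graphElt ((memLp_coeff_op_iff y).2 (memLp_coeff_graphFst ((graphFst π μ h).adjoint u))) by
    rw [this, graphFst_graphElt]
  refine ext_inner_right ℂ fun q => ?_
  obtain ⟨f, hf⟩ : ∃ f, π.op y f = graphFst π μ h q := (π.op y).surjective _
  have hfm : MemLp (coeff π h f) 2 μ :=
    (memLp_coeff_op_iff y).1 (hf ▸ memLp_coeff_graphFst q)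
  refine (ContinuousLinearMap.adjoint_inner_left (graphFst π μ h) q (π.op y u)).trans ?_
  refine Eq.trans ?_ (inner_graphElt_op _ q hfm hf.symm).symm
  refine Eq.trans ?_ (ContinuousLinearMap.adjoint_inner_left (graphFst π μ h) (graphElt hfm) u).symm
  rw [← hf, LinearIsometryEquiv.inner_map_map, graphFst_graphElt]

lemma IsIrreducible.exists_graphFst_adjoint_eq_smul (hπ : IsIrreducible π)
    (hf : MemLp (coeff π h f) 2 μ) (hne : f ≠ 0) :
    ∃ c : ℝ, c ≠ 0 ∧ ∀ v, graphFst π μ h ((graphFst π μ h).adjoint v) = (c : ℂ) • v := by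
  have hsa : IsSelfAdjoint (graphFst π μ h ∘L (graphFst π μ h).adjoint) := by
    rw [ContinuousLinearMap.isSelfAdjoint_iff', ContinuousLinearMap.adjoint_comp,
      ContinuousLinearMap.adjoint_adjoint]
  obtain ⟨c, hc⟩ := hπ.exists_eq_smul_of_isSelfAdjoint hsa adjoint_graphFst_op
  change ∀ v, graphFst π μ h ((graphFst π μ h).adjoint v) = (c : ℂ) • v at hc
  refine ⟨c, ?_, hc⟩
  rintro rfl
  have hadj : (graphFst π μ h).adjoint f = 0 := by
    rw [← inner_self_eq_zero (𝕜 := ℂ), ContinuousLinearMap.adjoint_inner_left, hc,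
      Complex.ofReal_zero, zero_smul, inner_zero_right]
  have hself := ContinuousLinearMap.adjoint_inner_left (graphFst π μ h) (graphElt hf) f
  rw [hadj, inner_zero_left, graphFst_graphElt] at hself
  exact hne (inner_self_eq_zero.1 hself.symm)

theorem IsIrreducible.exists_integral_norm_sq_coeff (hπ : IsIrreducible π) {f₀ : H}
    (hf₀ : MemLp (coeff π h f₀) 2 μ) (hne : f₀ ≠ 0) :
    ∃ c : ℝ, ∀ f, MemLp (coeff π h f) 2 μ ∧ ∫ x, ‖coeff π h f x‖ ^ 2 ∂μ = c * ‖f‖ ^ 2 := by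
  obtain ⟨c, hc0, hc⟩ := hπ.exists_graphFst_adjoint_eq_smul hf₀ hne
  have hmem : ∀ f, MemLp (coeff π h f) 2 μ := fun f => by
    have := memLp_coeff_graphFst ((graphFst π μ h).adjoint ((c : ℂ)⁻¹ • f))
    rwa [hc, smul_inv_smul₀ (by exact_mod_cast hc0)] at this
  refine ⟨c⁻¹ - 1, fun f => ⟨hmem f, ?_⟩⟩
  have hself := ContinuousLinearMap.adjoint_inner_left (graphFst π μ h) (graphElt (hmem f)) f
  rw [inner_coeffGraph, hc, graphFst_graphElt, coeff_smul_right] at hself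
  simp only [Pi.smul_apply, inner_smul_left, inner_self_eq_norm_sq_to_K, Complex.conj_ofReal,
    integral_const_mul, Complex.coe_algebraMap, ← Complex.ofReal_pow, integral_complex_ofReal]
    at hself
  have hreal : c * ‖f‖ ^ 2 + c * ∫ x, ‖coeff π h f x‖ ^ 2 ∂μ = ‖f‖ ^ 2 := by exact_mod_cast hself
  field_simp
  linarith

end CoefficientGraph

/-! ### Orthogonality relations and the formal degree -/

section Unimodular

variable {G : Type*} [Group G] [TopologicalSpace G] [IsTopologicalGroup G]
  [LocallyCompactSpace G] [MeasurableSpace G] [BorelSpace G]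

lemma isInvInvariant_of_unimodular (μ : Measure G) [μ.IsHaarMeasure] [μ.Regular]
    [μ.IsMulRightInvariant] : μ.IsInvInvariant := by
  have hinv : μ.inv = Measure.haarScalarFactor μ.inv μ • μ :=
    Measure.isMulLeftInvariant_eq_smul_of_regular μ.inv μ
  obtain ⟨K, hK, hK1⟩ := exists_compact_mem_nhds (1 : G)
  have hS : IsCompact (K ∪ K⁻¹) := hK.union hK.inv
  have hpos : μ (K ∪ K⁻¹) ≠ 0 :=
    (Measure.measure_pos_of_mem_nhds μ (mem_of_superset hK1 Set.subset_union_left)).ne'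
  have hmeas := congrArg (fun ν : Measure G => ν (K ∪ K⁻¹)) hinv
  simp only [Measure.inv_apply, Set.union_inv, inv_inv, Set.union_comm K⁻¹ K, Measure.smul_apply,
    ENNReal.smul_def, smul_eq_mul] at hmeas
  have hone : (Measure.haarScalarFactor μ.inv μ : ℝ≥0∞) = 1 :=
    (ENNReal.mul_left_inj hpos hS.measure_ne_top).1 (hmeas.symm.trans (one_mul _).symm)
  exact ⟨by rw [hinv, ENNReal.coe_eq_one.1 hone, one_smul]⟩

end Unimodular

section Polarization

variable {E F K : Type*} [NormedAddCommGroup E] [InnerProductSpace ℂ E]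
  [NormedAddCommGroup F] [InnerProductSpace ℂ F] [NormedAddCommGroup K] [InnerProductSpace ℂ K]

lemma inner_eq_of_norm_sq_eq (W : E →ₗ⋆[ℂ] F →ₗ[ℂ] K) {c : ℝ}
    (hW : ∀ g f, ‖W g f‖ ^ 2 = c * ‖f‖ ^ 2 * ‖g‖ ^ 2) (g₁ g₂ : E) (f₁ f₂ : F) :
    inner ℂ (W g₂ f₂) (W g₁ f₁) = c * inner ℂ f₂ f₁ * inner ℂ g₁ g₂ := by
  have hdiag : ∀ g, inner ℂ (W g f₂) (W g f₁) = c * inner ℂ f₂ f₁ * inner ℂ g g := fun g => by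
    have hW' : ∀ f, (‖W g f‖ : ℂ) ^ 2 = c * (‖f‖ : ℂ) ^ 2 * (‖g‖ : ℂ) ^ 2 := fun f => by
      exact_mod_cast hW g f
    rw [inner_eq_sum_norm_sq_div_four (W g f₂), inner_eq_sum_norm_sq_div_four f₂,
      inner_self_eq_norm_sq_to_K]
    simp only [← map_smul, ← map_add, ← map_sub, Complex.coe_algebraMap, hW']
    ring
  have hadd := hdiag (g₁ + g₂)
  have haddI := hdiag (g₁ + Complex.I • g₂)
  simp only [map_add, LinearMap.map_smulₛₗ, LinearMap.add_apply, LinearMap.smul_apply,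
    inner_add_left, inner_add_right, inner_smul_left, inner_smul_right, Complex.conj_I,
    map_neg, neg_neg, hdiag] at hadd haddI
  linear_combination (1 / 2) * hadd - (Complex.I / 2) * haddI
    + (1 / 2) * (inner ℂ (W g₂ f₂) (W g₁ f₁) - inner ℂ (W g₁ f₂) (W g₂ f₁)
      + c * inner ℂ f₂ f₁ * (inner ℂ g₂ g₁ - inner ℂ g₁ g₂)) * Complex.I_sq

end Polarization

section FormalDegree

variable {G : Type*} [Group G] [TopologicalSpace G] [MeasurableSpace G] {μ : Measure G}
  {H : Type*} [NormedAddCommGroup H] [InnerProductSpace ℂ H] {π : ProjectiveRep G H}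

lemma eq_zero_of_coeff_ae_eq_zero [NeZero μ] {h : H} (hz : ∀ f, coeff π h f =ᵐ[μ] 0) : h = 0 := by
  obtain ⟨s, hs, hrange⟩ := (π.stronglyMeasurable_op h).isSeparable_range
  have hae : ∀ᵐ x ∂μ, ∀ v ∈ s, coeff π h v x = 0 := (ae_ball_iff hs).2 fun v _ => hz v
  obtain ⟨x, hx⟩ := hae.exists
  have hclosed : IsClosed {v | inner ℂ (π.op x h) v = 0} :=
    isClosed_eq (by fun_prop) continuous_const
  have hself : inner ℂ (π.op x h) (π.op x h) = 0 :=
    closure_minimal hx hclosed (hrange (Set.mem_range_self x))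
  exact (π.op x).map_eq_zero_iff.1 (inner_self_eq_zero.1 hself)

lemma integrable_norm_sq_coeff_iff {g f : H} :
    Integrable (fun x => ‖coeff π g f x‖ ^ 2) μ ↔ MemLp (coeff π g f) 2 μ :=
  (memLp_two_iff_integrable_sq_norm (stronglyMeasurable_coeff π g f).aestronglyMeasurable).symm

/-- The coefficient transform `(g, f) ↦ V_g f` as a sesquilinear map into `L²(G)`. -/
noncomputable def coeffTransform (h : ∀ g f, MemLp (coeff π g f) 2 μ) :
    H →ₗ⋆[ℂ] H →ₗ[ℂ] Lp ℂ 2 μ :=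
  LinearMap.mk₂'ₛₗ (starRingEnd ℂ) (RingHom.id ℂ) (fun g f => (h g f).toLp)
    (fun g g' f => (MemLp.toLp_congr _ _ (coeff_add_left π g g' f).eventuallyEq).trans
      (MemLp.toLp_add (h g f) (h g' f)))
    (fun c g f => (MemLp.toLp_congr _ _ (coeff_smul_left π g f c).eventuallyEq).trans
      (MemLp.toLp_const_smul _ (h g f)))
    (fun g f f' => (MemLp.toLp_congr _ _ (coeff_add_right π g f f').eventuallyEq).trans
      (MemLp.toLp_add (h g f) (h g f')))
    (fun c g f => (MemLp.toLp_congr _ _ (coeff_smul_right π g f c).eventuallyEq).trans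
      (MemLp.toLp_const_smul c (h g f)))

lemma inner_coeffTransform (h : ∀ g f, MemLp (coeff π g f) 2 μ) (g₁ g₂ f₁ f₂ : H) :
    inner ℂ (coeffTransform h g₂ f₂) (coeffTransform h g₁ f₁)
      = ∫ x, coeff π g₁ f₁ x * star (coeff π g₂ f₂ x) ∂μ := by
  rw [L2.inner_def]
  refine integral_congr_ae ?_
  filter_upwards [(h g₁ f₁).coeFn_toLp, (h g₂ f₂).coeFn_toLp] with x h₁ h₂
  exact congrArg₂ (fun z w => z * star w) h₁ h₂

lemma isFormalDegree_of_integral_norm_sq {c : ℝ} (hc : 0 < c)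
    (h : ∀ g f, MemLp (coeff π g f) 2 μ ∧
      ∫ x, ‖coeff π g f x‖ ^ 2 ∂μ = c * ‖f‖ ^ 2 * ‖g‖ ^ 2) :
    IsFormalDegree π μ c⁻¹ := by
  have hmem := fun g f => (h g f).1
  have hnorm : ∀ g f, ‖coeffTransform hmem g f‖ ^ 2 = c * ‖f‖ ^ 2 * ‖g‖ ^ 2 := fun g f => by
    have hself := inner_coeffTransform hmem g g f f
    simp only [Complex.star_def, Complex.mul_conj, Complex.normSq_eq_norm_sq,
      inner_self_eq_norm_sq_to_K, integral_complex_ofReal, (h g f).2,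
      Complex.coe_algebraMap] at hself
    exact_mod_cast hself
  refine ⟨inv_pos.2 hc, fun f₁ f₂ g₁ g₂ => ?_⟩
  rw [← inner_coeffTransform hmem, inner_eq_of_norm_sq_eq _ hnorm, Complex.ofReal_inv, inv_inv,
    Complex.star_def, inner_conj_symm]

lemma IsDiscreteSeries.nontrivial (hπ : IsDiscreteSeries π μ) : Nontrivial H :=
  have ⟨_, h, hne, _⟩ := hπ
  ⟨h, 0, hne⟩

lemma IsFormalDegree.eq [Nontrivial H] {a b : ℝ} (ha : IsFormalDegree π μ a)
    (hb : IsFormalDegree π μ b) : a = b := by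
  obtain ⟨f, hf⟩ := exists_ne (0 : H)
  have hff : (inner ℂ f f : ℂ) ≠ 0 := inner_self_ne_zero.2 hf
  have hab := mul_right_cancel₀ hff (mul_right_cancel₀ (star_ne_zero.2 hff)
    ((ha.2 f f f f).symm.trans (hb.2 f f f f)))
  exact_mod_cast inv_injective hab

lemma IsFormalDegree.formalDegree_eq [Nontrivial H] {a : ℝ} (ha : IsFormalDegree π μ a) :
    formalDegree π μ = a := by
  have h : ∃ a, IsFormalDegree π μ a := ⟨a, ha⟩
  rw [formalDegree, dif_pos h]
  exact h.choose_spec.eq ha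

variable [IsTopologicalGroup G] [BorelSpace G] [μ.IsInvInvariant]

lemma memLp_coeff_swap {g f : H} (h : MemLp (coeff π g f) 2 μ) : MemLp (coeff π f g) 2 μ :=
  (h.comp_measurePreserving (Measure.measurePreserving_inv μ)).of_le
    (stronglyMeasurable_coeff π f g).aestronglyMeasurable
    (.of_forall fun x => (norm_coeff_swap π g f x).le)

lemma integral_norm_sq_coeff_swap (g f : H) :
    ∫ x, ‖coeff π f g x‖ ^ 2 ∂μ = ∫ x, ‖coeff π g f x‖ ^ 2 ∂μ := by
  simp only [norm_coeff_swap π g f]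
  exact integral_inv_eq_self (fun x => ‖coeff π g f x‖ ^ 2) μ

variable [CompleteSpace H] [μ.IsMulLeftInvariant] [NeZero μ]

lemma IsDiscreteSeries.exists_integral_norm_sq (hπ : IsDiscreteSeries π μ) :
    ∃ c : ℝ, 0 < c ∧ ∀ g f, MemLp (coeff π g f) 2 μ ∧
      ∫ x, ‖coeff π g f x‖ ^ 2 ∂μ = c * ‖f‖ ^ 2 * ‖g‖ ^ 2 := by
  obtain ⟨hirr, h, hne, hint⟩ := hπ
  have : 0 < ‖h‖ := norm_pos_iff.2 hne
  obtain ⟨c, hc⟩ := hirr.exists_integral_norm_sq_coeff (integrable_norm_sq_coeff_iff.1 hint) hne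
  have hc0 : 0 < c := by
    refine lt_of_le_of_ne ?_ fun h0 =>
      hne (eq_zero_of_coeff_ae_eq_zero (π := π) (μ := μ) fun f => ?_)
    · have : 0 ≤ c * ‖h‖ ^ 2 := (hc h).2 ▸ integral_nonneg fun x => by positivity
      exact nonneg_of_mul_nonneg_left this (by positivity)
    · have hzero := (hc f).2
      rw [← h0, zero_mul, integral_eq_zero_iff_of_nonneg (fun x => by positivity)
        (integrable_norm_sq_coeff_iff.2 (hc f).1)] at hzero
      filter_upwards [hzero] with x hx
      simpa using hx
  refine ⟨c / ‖h‖ ^ 2, by positivity, fun g f => ?_⟩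
  obtain ⟨c', hc'⟩ := hirr.exists_integral_norm_sq_coeff (memLp_coeff_swap (hc g).1) hne
  have hc'_eq : c' * ‖h‖ ^ 2 = c * ‖g‖ ^ 2 := by
    rw [← (hc' h).2, integral_norm_sq_coeff_swap, (hc g).2]
  refine ⟨(hc' f).1, ?_⟩
  rw [(hc' f).2]
  field_simp
  linear_combination ‖f‖ ^ 2 * hc'_eq

lemma IsDiscreteSeries.isFormalDegree (hπ : IsDiscreteSeries π μ) :
    IsFormalDegree π μ (formalDegree π μ) := by
  obtain ⟨c, hc, h⟩ := hπ.exists_integral_norm_sq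
  have := hπ.nontrivial
  have hd := isFormalDegree_of_integral_norm_sq hc h
  rwa [hd.formalDegree_eq]

lemma IsDiscreteSeries.formalDegree_pos (hπ : IsDiscreteSeries π μ) : 0 < formalDegree π μ :=
  hπ.isFormalDegree.1

lemma IsDiscreteSeries.memLp_coeff (hπ : IsDiscreteSeries π μ) (g f : H) :
    MemLp (coeff π g f) 2 μ := by
  obtain ⟨c, -, h⟩ := hπ.exists_integral_norm_sq
  exact (h g f).1

lemma IsDiscreteSeries.integrable_norm_sq_coeff (hπ : IsDiscreteSeries π μ) (g f : H) :
    Integrable (fun x => ‖coeff π g f x‖ ^ 2) μ :=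
  integrable_norm_sq_coeff_iff.2 (hπ.memLp_coeff g f)

lemma IsDiscreteSeries.integral_norm_sq_coeff (hπ : IsDiscreteSeries π μ) (g f : H) :
    ∫ x, ‖coeff π g f x‖ ^ 2 ∂μ = (formalDegree π μ)⁻¹ * ‖f‖ ^ 2 * ‖g‖ ^ 2 := by
  have h := hπ.isFormalDegree.2 f f g g
  simp only [Complex.star_def, Complex.mul_conj, Complex.normSq_eq_norm_sq, integral_complex_ofReal,
    inner_self_eq_norm_sq_to_K, map_pow, Complex.conj_ofReal, Complex.coe_algebraMap] at h
  exact_mod_cast h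

end FormalDegree

/-! ### Finite-dimensional subspaces attached to frames and Riesz sequences -/

section FiniteDimensional

variable {H : Type*} [NormedAddCommGroup H] [InnerProductSpace ℂ H]

lemma norm_sq_starProjection_eq_sum (W : Submodule ℂ H) [FiniteDimensional ℂ W] (v : H) :
    ‖W.starProjection v‖ ^ 2
      = ∑ i, ‖inner ℂ v ((stdOrthonormalBasis ℂ W i : W) : H)‖ ^ 2 := by
  calc ‖W.starProjection v‖ ^ 2 = ‖W.orthogonalProjectionOnto v‖ ^ 2 := rfl
    _ = ∑ i, ‖inner ℂ (stdOrthonormalBasis ℂ W i) (W.orthogonalProjectionOnto v)‖ ^ 2 :=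
        ((stdOrthonormalBasis ℂ W).sum_sq_norm_inner_right _).symm
    _ = _ := Finset.sum_congr rfl fun i _ => by
        rw [norm_inner_symm v, ← Submodule.inner_orthogonalProjectionOnto_eq_of_mem_left]

lemma norm_sq_sub_norm_sq_starProjection_le (W : Submodule ℂ H) [W.HasOrthogonalProjection]
    (v : H) {w : H} (hw : w ∈ W) : ‖v‖ ^ 2 - ‖W.starProjection v‖ ^ 2 ≤ ‖v - w‖ ^ 2 := by
  have hpyth : ‖v‖ ^ 2 - ‖W.starProjection v‖ ^ 2 = ‖v - W.starProjection v‖ ^ 2 := by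
    rw [W.norm_sq_eq_add_norm_sq_starProjection v, W.starProjection_orthogonal_val,
      add_sub_cancel_left]
  rw [hpyth, W.starProjection_minimal]
  refine pow_le_pow_left₀ (Real.iInf_nonneg fun _ => norm_nonneg _) ?_ 2
  exact ciInf_le (f := fun u : W => ‖v - u‖)
    ⟨0, Set.forall_mem_range.2 fun _ => norm_nonneg _⟩ ⟨w, hw⟩

variable {ι : Type*} {A : ℝ}

lemma norm_sq_starProjection_span_le [Fintype ι] (hA : 0 < A) (e : ι → H)
    (he : ∀ a : ι → ℂ, A * ∑ i, ‖a i‖ ^ 2 ≤ ‖∑ i, a i • e i‖ ^ 2)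
    [(Submodule.span ℂ (Set.range e)).HasOrthogonalProjection] (v : H) :
    A * ‖(Submodule.span ℂ (Set.range e)).starProjection v‖ ^ 2
      ≤ ∑ i, ‖inner ℂ (e i) v‖ ^ 2 := by
  set W := Submodule.span ℂ (Set.range e)
  obtain ⟨a, ha⟩ := (Submodule.mem_span_range_iff_exists_fun ℂ).1 (W.starProjection_apply_mem v)
  set p := ‖W.starProjection v‖
  have hp : p ^ 2 ≤ ∑ i, ‖a i‖ * ‖inner ℂ (e i) v‖ := by
    have hsub : (inner ℂ (W.starProjection v) (v - W.starProjection v) : ℂ) = 0 :=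
      W.inner_right_of_mem_orthogonal (W.starProjection_apply_mem v)
        (Submodule.sub_starProjection_mem_orthogonal v)
    have hinner : p ^ 2 = ‖(inner ℂ (W.starProjection v) v : ℂ)‖ := by
      rw [inner_sub_right, sub_eq_zero] at hsub
      rw [hsub, inner_self_eq_norm_sq_to_K, norm_pow, RCLike.norm_ofReal, sq_abs]
    rw [hinner, ← ha, sum_inner]
    refine (norm_sum_le _ _).trans_eq (Finset.sum_congr rfl fun i _ => ?_)
    rw [inner_smul_left, norm_mul, RCLike.norm_conj]
  have hCS : (p ^ 2) ^ 2 ≤ (∑ i, ‖a i‖ ^ 2) * ∑ i, ‖inner ℂ (e i) v‖ ^ 2 :=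
    (pow_le_pow_left₀ (by positivity) hp 2).trans (Finset.sum_mul_sq_le_sq_mul_sq _ _ _)
  have hlow : A * ∑ i, ‖a i‖ ^ 2 ≤ p ^ 2 := (he a).trans_eq (by rw [ha])
  have hS : 0 ≤ ∑ i, ‖inner ℂ (e i) v‖ ^ 2 := Finset.sum_nonneg fun _ _ => by positivity
  rcases (sq_nonneg p).eq_or_lt with h0 | h0
  · rwa [← h0, mul_zero]
  · refine le_of_mul_le_mul_right ?_ h0
    nlinarith [mul_le_mul_of_nonneg_right hlow hS]

lemma linearIndependent_of_bounded_below [Fintype ι] (hA : 0 < A) (e : ι → H)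
    (he : ∀ a : ι → ℂ, A * ∑ i, ‖a i‖ ^ 2 ≤ ‖∑ i, a i • e i‖ ^ 2) : LinearIndependent ℂ e := by
  refine Fintype.linearIndependent_iff.2 fun a ha i => ?_
  have hsum : ∑ i, ‖a i‖ ^ 2 ≤ 0 := by
    refine nonpos_of_mul_nonpos_right ((he a).trans_eq ?_) hA
    rw [ha, norm_zero, zero_pow two_ne_zero]
  have hi : ‖a i‖ ^ 2 ≤ 0 :=
    (Finset.single_le_sum (fun _ _ => by positivity) (Finset.mem_univ i)).trans hsum
  simpa using hi

lemma hasSum_norm_sq_lp (c : lp (fun _ : ι => ℂ) 2) : HasSum (fun i => ‖c i‖ ^ 2) (‖c‖ ^ 2) := by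
  simpa using lp.hasSum_norm (p := 2) (by norm_num) c

variable {F : Type*} [NormedAddCommGroup F] [InnerProductSpace ℂ F] [CompleteSpace H]

lemma exists_leftInverse_of_bounded_below (hA : 0 < A) (T : H →L[ℂ] F)
    (hT : ∀ v, A * ‖v‖ ^ 2 ≤ ‖T v‖ ^ 2) :
    ∃ L : F →ₗ[ℂ] H, (∀ v, L (T v) = v) ∧ ∀ k, A * ‖L k‖ ^ 2 ≤ ‖k‖ ^ 2 := by
  have hanti : AntilipschitzWith (Real.toNNReal (√A)⁻¹) T := by
    refine AddMonoidHomClass.antilipschitz_of_bound T fun v => ?_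
    rw [Real.coe_toNNReal _ (by positivity), inv_mul_eq_div, le_div_iff₀ (by positivity)]
    refine le_of_sq_le_sq ?_ (norm_nonneg _)
    rw [mul_pow, Real.sq_sqrt hA.le, mul_comm]
    exact hT v
  let R : Submodule ℂ F := T.range
  have : CompleteSpace R := (hanti.isComplete_range T.uniformContinuous).completeSpace_coe
  let e : H ≃ₗ[ℂ] R := LinearEquiv.ofInjective T.toLinearMap hanti.injective
  let L : F →ₗ[ℂ] H := e.symm.toLinearMap ∘ₗ R.orthogonalProjectionOnto.toLinearMap
  have hTL : ∀ k, T (L k) = R.starProjection k := fun k =>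
    congrArg Subtype.val (e.apply_symm_apply (R.orthogonalProjectionOnto k))
  refine ⟨L, fun v => hanti.injective ?_, fun k => (hT _).trans ?_⟩
  · rw [hTL]
    exact Submodule.starProjection_eq_self_iff.2 ⟨v, rfl⟩
  · rw [hTL]
    gcongr
    exact R.norm_starProjection_apply_le k

lemma exists_finrank_le_of_bounded_below (hA : 0 < A) (T : H →L[ℂ] lp (fun _ : ι => ℂ) 2)
    (hT : ∀ v, A * ‖v‖ ^ 2 ≤ ‖T v‖ ^ 2) (s : Finset ι) :
    ∃ W : Submodule ℂ H, ∃ _ : FiniteDimensional ℂ W, Module.finrank ℂ W ≤ s.card ∧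
      ∀ v, A * (‖v‖ ^ 2 - ‖W.starProjection v‖ ^ 2) ≤ ‖T v‖ ^ 2 - ∑ i ∈ s, ‖T v i‖ ^ 2 := by
  classical
  obtain ⟨L, hLT, hL⟩ := exists_leftInverse_of_bounded_below hA T hT
  let W : Submodule ℂ H :=
    Submodule.span ℂ (s.image fun i => L (lp.single 2 i (1 : ℂ)) : Finset H)
  refine ⟨W, FiniteDimensional.span_finset ℂ _,
    (finrank_span_finset_le_card _).trans Finset.card_image_le, fun v => ?_⟩
  have hmem : L (∑ i ∈ s, lp.single 2 i (T v i)) ∈ W := by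
    rw [map_sum]
    refine Submodule.sum_mem _ fun i hi => ?_
    have hsingle : (lp.single 2 i (T v i) : lp (fun _ : ι => ℂ) 2)
        = T v i • lp.single 2 i (1 : ℂ) := by
      rw [← lp.single_smul, smul_eq_mul, mul_one]
    rw [hsingle, map_smul]
    exact Submodule.smul_mem _ _ (Submodule.subset_span (Finset.mem_image_of_mem _ hi))
  calc A * (‖v‖ ^ 2 - ‖W.starProjection v‖ ^ 2)
      ≤ A * ‖v - L (∑ i ∈ s, lp.single 2 i (T v i))‖ ^ 2 := by
        gcongr
        exact norm_sq_sub_norm_sq_starProjection_le W v hmem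
    _ = A * ‖L (T v - ∑ i ∈ s, lp.single 2 i (T v i))‖ ^ 2 := by rw [map_sub, hLT]
    _ ≤ ‖T v - ∑ i ∈ s, lp.single 2 i (T v i)‖ ^ 2 := hL _
    _ = ‖T v‖ ^ 2 - ∑ i ∈ s, ‖T v i‖ ^ 2 := by
        simpa using lp.norm_compl_sum_single (p := 2) (by norm_num) (T v) s

end FiniteDimensional

section Frames

variable {G : Type*} [Group G] [TopologicalSpace G] [MeasurableSpace G]
  {H : Type*} [NormedAddCommGroup H] [InnerProductSpace ℂ H]
  {π : ProjectiveRep G H} {g : H} {Λ : Set G} {A B : ℝ}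

/-- The family `(π (p i) g)ᵢ` is a Bessel sequence with bound `B`. Finite sums avoid summability
hypotheses. -/
def IsBessel {ι : Type*} (π : ProjectiveRep G H) (g : H) (p : ι → G) (B : ℝ) : Prop :=
  ∀ (v : H) (s : Finset ι), ∑ i ∈ s, ‖coeff π g v (p i)‖ ^ 2 ≤ B * ‖v‖ ^ 2

lemma IsBessel.comp_injective {ι κ : Type*} {p : ι → G} (hp : IsBessel π g p B) {f : κ → ι}
    (hf : f.Injective) : IsBessel π g (p ∘ f) B := fun v s => by
  simpa only [Finset.sum_map, Function.Embedding.coeFn_mk, Function.comp_apply]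
    using hp v (s.map ⟨f, hf⟩)

lemma IsFrame.isBessel (hF : IsFrame π g Λ A B) : IsBessel π g ((↑) : Λ → G) B := fun v s =>
  ((hF v).1.sum_le_tsum s fun _ _ => by positivity).trans (hF v).2.2

lemma IsFrame.ne_zero [Nontrivial H] (hA : 0 < A) (hF : IsFrame π g Λ A B) : g ≠ 0 := by
  rintro rfl
  obtain ⟨v, hv⟩ := exists_ne (0 : H)
  have hlow := (hF v).2.1
  simp only [coeff, map_zero, inner_zero_left, norm_zero, zero_pow two_ne_zero, tsum_zero] at hlow
  have : 0 < A * ‖v‖ ^ 2 := by positivity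
  exact hlow.not_gt this

lemma IsFrame.exists_analysis (hF : IsFrame π g Λ A B) :
    ∃ T : H →L[ℂ] lp (fun _ : Λ => ℂ) 2, ∀ v (l : Λ), T v l = coeff π g v l := by
  have hmem (v : H) : Memℓp (fun l : Λ => coeff π g v l) 2 := memℓp_gen (by simpa using (hF v).1)
  let T : H →ₗ[ℂ] lp (fun _ : Λ => ℂ) 2 :=
    { toFun := fun v => ⟨fun l => coeff π g v l, hmem v⟩
      map_add' := fun v v' => by
        ext l
        exact congrFun (coeff_add_right π g v v') l
      map_smul' := fun a v => by
        ext l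
        exact congrFun (coeff_smul_right π g v a) l }
  refine ⟨T.mkContinuous √|B| fun v => le_of_sq_le_sq ?_ (by positivity), fun v l => rfl⟩
  rw [← (hasSum_norm_sq_lp (T v)).tsum_eq, mul_pow, Real.sq_sqrt (abs_nonneg B)]
  exact (hF v).2.2.trans (by gcongr; exact le_abs_self B)

lemma IsFrame.exists_subspace [CompleteSpace H] (hA : 0 < A) (hF : IsFrame π g Λ A B)
    (s : Finset Λ) :
    ∃ W : Submodule ℂ H, ∃ _ : FiniteDimensional ℂ W, Module.finrank ℂ W ≤ s.card ∧
      ∀ v, A * (‖v‖ ^ 2 - ‖W.starProjection v‖ ^ 2)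
        ≤ ∑' l : ↥((s : Set Λ)ᶜ), ‖coeff π g v (l : Λ)‖ ^ 2 := by
  obtain ⟨T, hT⟩ := hF.exists_analysis
  have hnorm (v : H) : ‖T v‖ ^ 2 = ∑' l : Λ, ‖coeff π g v l‖ ^ 2 := by
    simpa only [hT] using (hasSum_norm_sq_lp (T v)).tsum_eq.symm
  obtain ⟨W, hW, hcard, hdist⟩ :=
    exists_finrank_le_of_bounded_below hA T (fun v => (hF v).2.1.trans_eq (hnorm v).symm) s
  refine ⟨W, hW, hcard, fun v => (hdist v).trans_eq ?_⟩
  rw [hnorm, sub_eq_iff_eq_add', ← (hF v).1.sum_add_tsum_compl (s := s)]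
  simp only [hT]

lemma IsRieszSequence.bounded_below (hR : IsRieszSequence π g Λ A B) (s : Finset Λ) (a : s → ℂ) :
    A * ∑ l, ‖a l‖ ^ 2 ≤ ‖∑ l, a l • π.op ((l : Λ) : G) g‖ ^ 2 := by
  classical
  let b : Λ → ℂ := Function.extend Subtype.val a 0
  have hb (l : s) : b l = a l := Subtype.val_injective.extend_apply a 0 l
  let c : lp (fun _ : Λ => ℂ) 2 := ∑ l ∈ s, lp.single 2 l (b l)
  have hc (l : Λ) : c l = if l ∈ s then b l else 0 := by
    simp only [c, lp.coeFn_sum, Finset.sum_apply]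
    simp [Pi.single_apply]
  have hnorm : ‖c‖ ^ 2 = ∑ l, ‖a l‖ ^ 2 := by
    have h := lp.norm_sum_single (p := 2) (by norm_num) b s
    rw [← Finset.sum_coe_sort s fun l => ‖b l‖ ^ (2 : ℝ≥0∞).toReal] at h
    simpa only [hb, ENNReal.toReal_ofNat, Real.rpow_ofNat] using h
  have hsynth : ∑' l : Λ, c l • π.op (l : G) g = ∑ l, a l • π.op ((l : Λ) : G) g := by
    rw [tsum_eq_sum (s := s) fun l hl => by rw [hc, if_neg hl, zero_smul], ← Finset.sum_coe_sort s]
    exact Finset.sum_congr rfl fun l _ => by rw [hc, if_pos l.2, hb]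
  rw [← hnorm, ← hsynth]
  exact (hR c).2.1

lemma IsRieszSequence.linearIndependent (hA : 0 < A) (hR : IsRieszSequence π g Λ A B)
    (s : Finset Λ) : LinearIndependent ℂ fun l : s => π.op ((l : Λ) : G) g :=
  linearIndependent_of_bounded_below hA _ (hR.bounded_below s)

lemma IsRieszSequence.ne_zero (hA : 0 < A) (hR : IsRieszSequence π g Λ A B) (hΛ : Λ.Nonempty) :
    g ≠ 0 := by
  rintro rfl
  obtain ⟨l, hl⟩ := hΛ
  exact (hR.linearIndependent hA {⟨l, hl⟩}).ne_zero ⟨⟨l, hl⟩, by simp⟩ (map_zero _)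

lemma IsRieszSequence.exists_subspace (hA : 0 < A) (hR : IsRieszSequence π g Λ A B)
    (s : Finset Λ) :
    ∃ W : Submodule ℂ H, ∃ _ : FiniteDimensional ℂ W, Module.finrank ℂ W = s.card ∧
      ∀ v, A * ‖W.starProjection v‖ ^ 2 ≤ ∑ l ∈ s, ‖coeff π g v l‖ ^ 2 := by
  have := FiniteDimensional.span_of_finite ℂ
    (Set.finite_range fun l : s => π.op ((l : Λ) : G) g)
  refine ⟨_, this, ?_, fun v => ?_⟩
  · rw [finrank_span_eq_card (hR.linearIndependent hA s), Fintype.card_coe]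
  · rw [← Finset.sum_coe_sort s]
    exact norm_sq_starProjection_span_le hA _ (hR.bounded_below s) v

end Frames

section Integration

variable {G : Type*} [Group G] [TopologicalSpace G] [MeasurableSpace G] [IsTopologicalGroup G]
  [BorelSpace G] {H : Type*} [NormedAddCommGroup H] [InnerProductSpace ℂ H] [CompleteSpace H]
  {π : ProjectiveRep G H} {μ : Measure G} [μ.IsMulLeftInvariant] [μ.IsInvInvariant] [NeZero μ]

lemma IsDiscreteSeries.integrable_norm_sq_starProjection_op (hπ : IsDiscreteSeries π μ) (g : H)
    (W : Submodule ℂ H) [FiniteDimensional ℂ W] :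
    Integrable (fun x => ‖W.starProjection (π.op x g)‖ ^ 2) μ := by
  simp only [norm_sq_starProjection_eq_sum]
  exact integrable_finsetSum _ fun i _ => hπ.integrable_norm_sq_coeff g _

lemma IsDiscreteSeries.integral_norm_sq_starProjection_op (hπ : IsDiscreteSeries π μ) (g : H)
    (W : Submodule ℂ H) [FiniteDimensional ℂ W] :
    ∫ x, ‖W.starProjection (π.op x g)‖ ^ 2 ∂μ
      = (formalDegree π μ)⁻¹ * ‖g‖ ^ 2 * Module.finrank ℂ W := by
  have hi (i) : ∫ x, ‖coeff π g (stdOrthonormalBasis ℂ W i : H) x‖ ^ 2 ∂μ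
      = (formalDegree π μ)⁻¹ * ‖g‖ ^ 2 := by
    rw [hπ.integral_norm_sq_coeff, Submodule.norm_coe, (stdOrthonormalBasis ℂ W).norm_eq_one,
      one_pow, mul_one]
  simp only [norm_sq_starProjection_eq_sum]
  calc ∫ x, ∑ i, ‖coeff π g (stdOrthonormalBasis ℂ W i : H) x‖ ^ 2 ∂μ
      = ∑ i, ∫ x, ‖coeff π g (stdOrthonormalBasis ℂ W i : H) x‖ ^ 2 ∂μ :=
        integral_finsetSum _ fun i _ => hπ.integrable_norm_sq_coeff g _
    _ = _ := by
        simp only [hi, Finset.sum_const, Finset.card_univ, Fintype.card_fin, nsmul_eq_mul]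
        ring

end Integration

/-! ### Geometry of periodic metrics -/

section Geometry

variable {G : Type*} [Group G] [TopologicalSpace G] [MeasurableSpace G] {d : G → G → ℝ}

namespace IsPeriodicMetric

lemma dist_self (hd : IsPeriodicMetric d) (x : G) : d x x = 0 := (hd.eq_zero_iff x x).2 rfl

lemma dist_one_inv_mul (hd : IsPeriodicMetric d) (x y : G) : d 1 (x⁻¹ * y) = d x y := by
  rw [← hd.left_invariant x y x⁻¹, inv_mul_cancel]

lemma dist_inv_mul_one (hd : IsPeriodicMetric d) (x y : G) : d (y⁻¹ * x) 1 = d x y := by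
  rw [hd.symm, hd.dist_one_inv_mul, hd.symm]

lemma dist_inv_one (hd : IsPeriodicMetric d) (x : G) : d x⁻¹ 1 = d x 1 := by
  rw [← mul_one x⁻¹, hd.dist_inv_mul_one, hd.symm]

lemma dist_mul_one_le (hd : IsPeriodicMetric d) (x y : G) : d (x * y) 1 ≤ d x 1 + d y 1 := by
  have h := hd.triangle (x * y) x 1
  rw [← hd.dist_inv_mul_one (x * y) x, inv_mul_cancel_left] at h
  linarith

lemma one_add_dist_mul_one_le (hd : IsPeriodicMetric d) (x y : G) :
    1 + d (x * y) 1 ≤ (1 + d x 1) * (1 + d y 1) := by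
  nlinarith [hd.dist_mul_one_le x y, mul_nonneg (hd.nonneg x 1) (hd.nonneg y 1)]

lemma measurable_dist_one (hd : IsPeriodicMetric d) : Measurable fun x => d x 1 :=
  hd.measurable.comp (measurable_id.prodMk measurable_const)

lemma measurableSet_oball (hd : IsPeriodicMetric d) (r : ℝ) : MeasurableSet (oball d r) :=
  hd.measurable_dist_one measurableSet_Iio

lemma exists_subset_oball (hd : IsPeriodicMetric d) {K : Set G} (hK : IsCompact K) :
    ∃ ρ : ℝ, 0 < ρ ∧ K ⊆ oball d ρ := by
  obtain ⟨M, hM⟩ := hd.locally_bounded (K ×ˢ {1}) (hK.prod isCompact_singleton)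
  refine ⟨max M 0 + 1, by positivity, fun x hx => ?_⟩
  calc d x 1 ≤ M := hM ⟨(x, 1), ⟨hx, rfl⟩, rfl⟩
    _ ≤ max M 0 := le_max_left M 0
    _ < max M 0 + 1 := lt_add_one _

lemma exists_oball_mem_nhds [LocallyCompactSpace G] (hd : IsPeriodicMetric d) :
    ∃ ρ : ℝ, 0 < ρ ∧ oball d ρ ∈ 𝓝 (1 : G) := by
  obtain ⟨K, hK, h1⟩ := exists_compact_mem_nhds (1 : G)
  obtain ⟨ρ, hρ, hsub⟩ := hd.exists_subset_oball hK
  exact ⟨ρ, hρ, mem_of_superset h1 hsub⟩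

lemma measure_oball_lt_top (hd : IsPeriodicMetric d) (μ : Measure G)
    [IsFiniteMeasureOnCompacts μ] (r : ℝ) : μ (oball d r) < ⊤ := by
  refine (measure_mono fun x hx => subset_closure ?_).trans_lt (hd.proper r).measure_lt_top
  exact (hd.symm 1 x).trans_le (le_of_lt hx)

lemma closure_oball_subset [IsTopologicalGroup G] (hd : IsPeriodicMetric d) {ρ : ℝ}
    (hρ : oball d ρ ∈ 𝓝 (1 : G)) (r : ℝ) : closure (oball d r) ⊆ oball d (r + ρ) := by
  intro x hx
  have hnhd : (fun y => x⁻¹ * y) ⁻¹' oball d ρ ∈ 𝓝 x :=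
    (continuous_const_mul x⁻¹).continuousAt.preimage_mem_nhds (by simpa using hρ)
  obtain ⟨y, hyx, hyr⟩ := mem_closure_iff_nhds.1 hx _ hnhd
  calc d x 1 ≤ d x y + d y 1 := hd.triangle x y 1
    _ = d (x⁻¹ * y) 1 + d y 1 := by rw [hd.dist_inv_mul_one, hd.symm]
    _ < ρ + r := add_lt_add hyx hyr
    _ = r + ρ := add_comm ρ r

/- Cut the chain greedily into blocks of length at least `s`: each completed block contributes one
factor from `V`, and `t` is the length of the unfinished block. -/
lemma exists_mem_pow_of_chain (hd : IsPeriodicMetric d) {s : ℝ} {V : Set G}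
    (hV : ∀ y, d 1 y ≤ 2 * s → y ∈ V) (hs : 0 ≤ s) {p : ℕ → G} (h0 : p 0 = 1) (n : ℕ)
    (hstep : ∀ i < n, d (p i) (p (i + 1)) ≤ s) :
    ∃ (m : ℕ) (q : G) (t : ℝ), q ∈ V ^ m ∧ d q (p n) ≤ t ∧ t ≤ s ∧
      t + m * s ≤ ∑ i ∈ Finset.range n, d (p i) (p (i + 1)) := by
  induction n with
  | zero => exact ⟨0, 1, 0, by simp, by rw [h0, hd.dist_self], hs, by simp⟩
  | succ n ih =>
    obtain ⟨m, q, t, hq, hqt, hts, hsum⟩ := ih fun i hi => hstep i (by lia)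
    have hstep := hstep n n.lt_succ_self
    have htri := hd.triangle q (p n) (p (n + 1))
    rw [Finset.sum_range_succ]
    by_cases hblock : t + d (p n) (p (n + 1)) ≤ s
    · exact ⟨m, q, _, hq, by linarith, hblock, by linarith⟩
    · refine ⟨m + 1, p (n + 1), 0, ?_, (hd.dist_self _).le, hs, by push_cast; linarith⟩
      rw [pow_succ]
      refine ⟨q, hq, q⁻¹ * p (n + 1), hV _ ?_, mul_inv_cancel_left _ _⟩
      rw [hd.dist_one_inv_mul]
      linarith

lemma mem_pow_of_chain (hd : IsPeriodicMetric d) {s : ℝ} {V : Set G}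
    (hV : ∀ y, d 1 y ≤ 2 * s → y ∈ V) (hs : 0 ≤ s) {p : ℕ → G} (h0 : p 0 = 1) (n : ℕ)
    (hstep : ∀ i < n, d (p i) (p (i + 1)) ≤ s) :
    ∃ m : ℕ, m * s ≤ ∑ i ∈ Finset.range n, d (p i) (p (i + 1)) ∧ p n ∈ V ^ (m + 1) := by
  obtain ⟨m, q, t, hq, hqt, hts, hsum⟩ := hd.exists_mem_pow_of_chain hV hs h0 n hstep
  have ht : 0 ≤ t := (hd.nonneg _ _).trans hqt
  refine ⟨m, by linarith, ?_⟩
  rw [pow_succ]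
  refine ⟨q, hq, q⁻¹ * p n, hV _ ?_, mul_inv_cancel_left _ _⟩
  rw [hd.dist_one_inv_mul]
  linarith

lemma exists_oball_subset_pow (hd : IsPeriodicMetric d) {U : Set G} (h1 : (1 : G) ∈ U)
    (hU : ∀ K, IsCompact K → ∃ k : ℕ, K ⊆ U ^ k) :
    ∃ M : ℕ, 0 < M ∧ ∀ r : ℝ, 1 ≤ r → oball d r ⊆ U ^ (M * ⌈r⌉₊) := by
  obtain ⟨s, hs, hgeo⟩ := hd.asymptotically_geodesic 1 one_pos
  obtain ⟨k, hk⟩ := hU _ (hd.proper (2 * s))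
  refine ⟨(k + 1) * (⌈2 / s⌉₊ + 1), by positivity, fun r hr x hx => ?_⟩
  obtain ⟨n, p, hp0, rfl, hsum, hstep⟩ := hgeo 1 x
  have hV (y : G) (hy : d 1 y ≤ 2 * s) : y ∈ U ^ (k + 1) :=
    Set.pow_subset_pow_right h1 k.le_succ (hk (subset_closure hy))
  obtain ⟨m, hm, hmem⟩ := hd.mem_pow_of_chain hV hs.le hp0 n hstep
  rw [← pow_mul] at hmem
  refine Set.pow_subset_pow_right h1 ?_ hmem
  rw [mul_assoc]
  refine Nat.mul_le_mul_left _ ?_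
  have hxr : d 1 (p n) < r := (hd.symm _ _).trans_lt hx
  have hmr : (m : ℝ) ≤ 2 / s * r := by
    rw [div_mul_eq_mul_div, le_div_iff₀ hs]
    linarith
  have hceil : ((m + 1 : ℕ) : ℝ) ≤ ((⌈2 / s⌉₊ + 1) * ⌈r⌉₊ : ℕ) := by
    push_cast
    calc (m : ℝ) + 1 ≤ 2 / s * r + r := add_le_add hmr hr
      _ = (2 / s + 1) * r := by ring
      _ ≤ (⌈2 / s⌉₊ + 1) * ⌈r⌉₊ := by gcongr <;> exact Nat.le_ceil _
  exact_mod_cast hceil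

end IsPeriodicMetric

section Generation

variable {Γ : Type*} [Group Γ] {U : Set Γ}

lemma exists_mem_pow_of_closure_eq_top (hinv : U⁻¹ = U) (hgen : Subgroup.closure U = ⊤) (x : Γ) :
    ∃ k : ℕ, x ∈ U ^ k := by
  have hx : x ∈ Subgroup.closure U := hgen ▸ Subgroup.mem_top x
  induction hx using Subgroup.closure_induction with
  | mem x hx => exact ⟨1, by rwa [pow_one]⟩
  | one => exact ⟨0, Set.one_mem_one⟩
  | mul x y _ _ hx hy =>
    obtain ⟨m, hm⟩ := hx
    obtain ⟨n, hn⟩ := hy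
    exact ⟨m + n, pow_add U m n ▸ Set.mul_mem_mul hm hn⟩
  | inv x _ hx =>
    obtain ⟨m, hm⟩ := hx
    refine ⟨m, ?_⟩
    rw [← hinv, inv_pow]
    exact Set.inv_mem_inv.2 hm

lemma exists_subset_pow_of_isCompact [TopologicalSpace Γ] [IsTopologicalGroup Γ]
    (hU : U ∈ 𝓝 (1 : Γ)) (hinv : U⁻¹ = U) (hgen : Subgroup.closure U = ⊤) {K : Set Γ}
    (hK : IsCompact K) : ∃ k : ℕ, K ⊆ U ^ k := by
  have h1U : (1 : Γ) ∈ U := mem_of_mem_nhds hU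
  refine hK.induction_on (p := fun s => ∃ k : ℕ, s ⊆ U ^ k) ⟨0, Set.empty_subset _⟩
    (fun s t hst ⟨k, hk⟩ => ⟨k, hst.trans hk⟩) ?_ fun x _ => ?_
  · rintro s t ⟨k, hk⟩ ⟨l, hl⟩
    exact ⟨max k l, Set.union_subset
      (hk.trans (Set.pow_subset_pow_right h1U (le_max_left k l)))
      (hl.trans (Set.pow_subset_pow_right h1U (le_max_right k l)))⟩
  · obtain ⟨k, hk⟩ := exists_mem_pow_of_closure_eq_top hinv hgen x
    have hnhd : (fun y => x⁻¹ * y) ⁻¹' U ∈ 𝓝 x :=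
      (continuous_const_mul x⁻¹).continuousAt.preimage_mem_nhds (by simpa using hU)
    refine ⟨U ^ (k + 1), mem_nhdsWithin_of_mem_nhds (mem_of_superset hnhd fun y hy => ?_),
      k + 1, subset_rfl⟩
    rw [pow_succ]
    exact ⟨x, hk, x⁻¹ * y, hy, mul_inv_cancel_left _ _⟩

end Generation

variable {μ : Measure G} {D : ℝ}

lemma HasPolynomialGrowth.exists_measure_oball_le [IsTopologicalGroup G]
    (hG : HasPolynomialGrowth μ D) (hd : IsPeriodicMetric d) :
    ∃ C : ℝ, ∀ r : ℝ, 1 ≤ r → μ (oball d r) ≤ ENNReal.ofReal (C * r ^ D) := by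
  obtain ⟨hD, U, -, hU, hinv, hgen, C, hC1, hC⟩ := hG
  obtain ⟨M, hM, hsub⟩ := hd.exists_oball_subset_pow (mem_of_mem_nhds hU)
    fun K => exists_subset_pow_of_isCompact hU hinv hgen
  refine ⟨C * (M * 2) ^ D, fun r hr => ?_⟩
  have hr0 : 0 < r := by linarith
  have hceil : (⌈r⌉₊ : ℝ) ≤ 2 * r := by linarith [Nat.ceil_lt_add_one hr0.le]
  calc μ (oball d r) ≤ μ (U ^ (M * ⌈r⌉₊)) := measure_mono (hsub r hr)
    _ ≤ ENNReal.ofReal (C * ((M * ⌈r⌉₊ : ℕ) : ℝ) ^ D) :=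
        hC _ (Nat.mul_pos hM (Nat.ceil_pos.2 hr0))
    _ ≤ ENNReal.ofReal (C * (M * (2 * r)) ^ D) := by
        push_cast
        gcongr
    _ = ENNReal.ofReal (C * (M * 2) ^ D * r ^ D) := by
        rw [mul_assoc, ← Real.mul_rpow (by positivity) hr0.le, mul_assoc]

lemma IsPeriodicMetric.ofReal_one_add_rpow_neg_le_tsum (hd : IsPeriodicMetric d) {p : ℝ}
    (hp : 0 ≤ p) (x : G) :
    ENNReal.ofReal ((1 + d x 1) ^ (-p)) ≤ ∑' k : ℕ, (oball d (2 ^ (k + 1))).indicator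
      (fun _ => ENNReal.ofReal (((2 : ℝ) ^ k) ^ (-p))) x := by
  obtain ⟨k, hk, hk'⟩ := exists_nat_pow_near (x := 1 + d x 1) (y := 2)
    (by linarith [hd.nonneg x 1]) one_lt_two
  have hx : x ∈ oball d (2 ^ (k + 1)) := show d x 1 < _ by linarith
  refine le_trans ?_ (ENNReal.le_tsum k)
  rw [Set.indicator_of_mem hx]
  exact ENNReal.ofReal_le_ofReal
    (Real.rpow_le_rpow_of_nonpos (by positivity) hk (neg_nonpos.2 hp))

lemma IsPeriodicMetric.lintegral_one_add_rpow_neg_lt_top (hd : IsPeriodicMetric d) {C p : ℝ}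
    (hgrowth : ∀ r : ℝ, 1 ≤ r → μ (oball d r) ≤ ENNReal.ofReal (C * r ^ D)) (hp : 0 ≤ p)
    (hDp : D < p) : ∫⁻ x, ENNReal.ofReal ((1 + d x 1) ^ (-p)) ∂μ < ⊤ := by
  have hterm (k : ℕ) : ∫⁻ x, (oball d (2 ^ (k + 1))).indicator
      (fun _ => ENNReal.ofReal (((2 : ℝ) ^ k) ^ (-p))) x ∂μ
      ≤ ENNReal.ofReal (C * 2 ^ D * (2 ^ (D - p)) ^ k) := by
    rw [lintegral_indicator_const (hd.measurableSet_oball _)]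
    refine (mul_le_mul_right (hgrowth _ (one_le_pow₀ one_le_two)) _).trans_eq ?_
    rw [← ENNReal.ofReal_mul (by positivity), pow_succ, Real.mul_rpow (by positivity) two_pos.le,
      ← Real.rpow_natCast_mul two_pos.le, ← Real.rpow_natCast_mul two_pos.le,
      ← Real.rpow_mul_natCast two_pos.le, mul_comm (D - p), mul_sub, sub_eq_add_neg, ← mul_neg,
      Real.rpow_add two_pos]
    congr 1
    ring
  calc ∫⁻ x, ENNReal.ofReal ((1 + d x 1) ^ (-p)) ∂μ
      ≤ ∫⁻ x, ∑' k : ℕ, (oball d (2 ^ (k + 1))).indicator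
          (fun _ => ENNReal.ofReal (((2 : ℝ) ^ k) ^ (-p))) x ∂μ :=
        lintegral_mono (hd.ofReal_one_add_rpow_neg_le_tsum hp)
    _ = ∑' k : ℕ, ∫⁻ x, (oball d (2 ^ (k + 1))).indicator
          (fun _ => ENNReal.ofReal (((2 : ℝ) ^ k) ^ (-p))) x ∂μ :=
        lintegral_tsum fun k =>
          (measurable_const.indicator (hd.measurableSet_oball _)).aemeasurable
    _ ≤ ∑' k : ℕ, ENNReal.ofReal (C * 2 ^ D * (2 ^ (D - p)) ^ k) := ENNReal.tsum_le_tsum hterm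
    _ < ⊤ := ((summable_geometric_of_lt_one (by positivity)
        (Real.rpow_lt_one_of_one_lt_of_neg one_lt_two (by linarith))).mul_left _).tsum_ofReal_lt_top

variable {H : Type*} [NormedAddCommGroup H] [InnerProductSpace ℂ H]

lemma IsPeriodicMetric.localMax_le_of_decay (hd : IsPeriodicMetric d) {F : G → ℂ} {C₀ e ρ : ℝ}
    (he : 0 ≤ e) (hF : ∀ x, ‖F x‖ ≤ C₀ * (1 + d x 1) ^ (-e)) {Q : Set G} (hQ : Q ⊆ oball d ρ)
    (x : G) :
    localMax Q F x ≤ ENNReal.ofReal (C₀ * (1 + ρ) ^ e * (1 + d x 1) ^ (-e)) := by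
  have hC₀ : 0 ≤ C₀ := by simpa [hd.dist_self] using (norm_nonneg _).trans (hF 1)
  refine iSup₂_le fun z hz => ?_
  have hzρ : d z 1 < ρ := hQ hz
  have hx := hd.nonneg x 1
  have hρ : 0 < 1 + ρ := by linarith [hd.nonneg z 1]
  have hpeetre : (1 + d x 1) / (1 + ρ) ≤ 1 + d (x * z) 1 := by
    rw [div_le_iff₀ hρ]
    calc 1 + d x 1 = 1 + d (x * z * z⁻¹) 1 := by rw [mul_inv_cancel_right]
      _ ≤ (1 + d (x * z) 1) * (1 + d z⁻¹ 1) := hd.one_add_dist_mul_one_le _ _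
      _ ≤ (1 + d (x * z) 1) * (1 + ρ) := by
          rw [hd.dist_inv_one]
          gcongr
          linarith [hd.nonneg (x * z) 1]
  rw [← ofReal_norm]
  refine ENNReal.ofReal_le_ofReal ((hF _).trans ?_)
  rw [mul_assoc]
  gcongr
  refine (Real.rpow_le_rpow_of_nonpos (by positivity) hpeetre (by linarith)).trans_eq ?_
  rw [Real.div_rpow (by positivity) hρ.le, Real.rpow_neg hρ.le, div_inv_eq_mul, mul_comm]

theorem mem_localizedVectors_of_decay [IsTopologicalGroup G] (hG : HasPolynomialGrowth μ D)
    (hd : IsPeriodicMetric d) (π : ProjectiveRep G H) {g : H} {C₀ α β : ℝ} (hα : 0 < α)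
    (hβ : 0 < β) (h : ∀ x : G, ‖coeff π g g x‖ ≤ C₀ * (1 + d x 1) ^ (-((D + α + β) / 2)))
    {Q : Set G} (hQ : IsCompact (closure Q)) :
    g ∈ localizedVectors π μ Q (polyWeight d α) := by
  obtain ⟨C, hgrowth⟩ := hG.exists_measure_oball_le hd
  obtain ⟨ρ, hρ, hQρ⟩ := hd.exists_subset_oball hQ
  have hD := hG.1
  have hmax := hd.localMax_le_of_decay (by positivity) h (subset_closure.trans hQρ)
  have hC₀ : 0 ≤ C₀ := by simpa [hd.dist_self] using (norm_nonneg _).trans (h 1)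
  set K := C₀ * (1 + ρ) ^ ((D + α + β) / 2)
  have hbound (x : G) : localMax Q (coeff π g g) x ^ 2 * ENNReal.ofReal (polyWeight d α x)
      ≤ ENNReal.ofReal (K ^ 2) * ENNReal.ofReal ((1 + d x 1) ^ (-(D + β))) := by
    have hx : 0 < 1 + d x 1 := by linarith [hd.nonneg x 1]
    have hrpow : (K * (1 + d x 1) ^ (-((D + α + β) / 2))) ^ 2 * polyWeight d α x
        = K ^ 2 * (1 + d x 1) ^ (-(D + β)) := by
      rw [polyWeight, mul_pow, mul_assoc, ← Real.rpow_mul_natCast hx.le, ← Real.rpow_add hx]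
      congr 2
      push_cast
      ring
    calc localMax Q (coeff π g g) x ^ 2 * ENNReal.ofReal (polyWeight d α x)
        ≤ ENNReal.ofReal (K * (1 + d x 1) ^ (-((D + α + β) / 2))) ^ 2
            * ENNReal.ofReal (polyWeight d α x) := by
          gcongr
          exact hmax x
      _ = ENNReal.ofReal ((K * (1 + d x 1) ^ (-((D + α + β) / 2))) ^ 2 * polyWeight d α x) := by
          rw [← ENNReal.ofReal_pow (by positivity), ENNReal.ofReal_mul (by positivity)]
      _ = _ := by rw [hrpow, ENNReal.ofReal_mul (by positivity)]
  calc ∫⁻ x, localMax Q (coeff π g g) x ^ 2 * ENNReal.ofReal (polyWeight d α x) ∂μ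
      ≤ ∫⁻ x, ENNReal.ofReal (K ^ 2) * ENNReal.ofReal ((1 + d x 1) ^ (-(D + β))) ∂μ :=
        lintegral_mono hbound
    _ = ENNReal.ofReal (K ^ 2) * ∫⁻ x, ENNReal.ofReal ((1 + d x 1) ^ (-(D + β))) ∂μ :=
        lintegral_const_mul' _ _ ENNReal.ofReal_ne_top
    _ < ⊤ := ENNReal.mul_lt_top ENNReal.ofReal_lt_top
        (hd.lintegral_one_add_rpow_neg_lt_top hgrowth (by linarith) (by linarith))

end Geometry

/-! ### Counting and localization estimates -/

section Estimates

lemma enorm_le_localMax {Γ : Type*} [Group Γ] {Q : Set Γ} (F : Γ → ℂ) (x : Γ) {z : Γ} (hz : z ∈ Q) :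
    ‖F (x * z)‖ₑ ≤ localMax Q F x :=
  le_iSup₂ (f := fun z (_ : z ∈ Q) => ‖F (x * z)‖ₑ) z hz

lemma isAdmissibleNhd_interior {Γ : Type*} [Group Γ] [TopologicalSpace Γ] [IsTopologicalGroup Γ]
    {Q : Set Γ} (hQ : IsAdmissibleNhd Q) :
    IsAdmissibleNhd (interior Q) :=
  ⟨interior_mem_nhds.2 hQ.1, hQ.2.1.of_isClosed_subset isClosed_closure
    (closure_mono interior_subset), by
      simpa only [Homeomorph.coe_inv, Set.inv_preimage, hQ.2.2]
        using (Homeomorph.inv Γ).preimage_interior Q⟩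

variable {G : Type*} [Group G] [TopologicalSpace G] [MeasurableSpace G] {d : G → G → ℝ}
  {H : Type*} [NormedAddCommGroup H] [InnerProductSpace ℂ H] {π : ProjectiveRep G H} {g : H}
  {α ρ s B : ℝ} {μ : Measure G}

lemma norm_coeff_op_right_symm (π : ProjectiveRep G H) (g : H) (t l : G) :
    ‖coeff π g (π.op t g) l‖ = ‖coeff π g g (l⁻¹ * t)‖ := by
  rw [norm_coeff_op_right, norm_coeff_swap, mul_inv_rev, inv_inv]

lemma IsPeriodicMetric.exists_setIntegral_oball_pos (hd : IsPeriodicMetric d) {f : G → ℝ}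
    (hf : Integrable f μ) (hpos : 0 < ∫ x, f x ∂μ) : ∃ R : ℝ, 0 < ∫ x in oball d R, f x ∂μ := by
  have hunion : ⋃ n : ℕ, oball d (n : ℝ) = Set.univ :=
    Set.eq_univ_of_forall fun x => Set.mem_iUnion.2 (exists_nat_gt (d x 1))
  have hmono : Monotone fun n : ℕ => oball d (n : ℝ) := fun m n hmn x (hx : d x 1 < m) =>
    show d x 1 < n from hx.trans_le (Nat.cast_le.2 hmn)
  have hlim := tendsto_setIntegral_of_monotone (fun n : ℕ => hd.measurableSet_oball n) hmono
    (hf.integrableOn (s := ⋃ n : ℕ, oball d (n : ℝ)))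
  rw [hunion, setIntegral_univ] at hlim
  obtain ⟨n, hn⟩ := (hlim.eventually_const_lt hpos).exists
  exact ⟨n, hn⟩

lemma IsPeriodicMetric.measurableSet_dist_lt (hd : IsPeriodicMetric d) (y : G) (r : ℝ) :
    MeasurableSet {t | d t y < r} :=
  (hd.measurable.comp (measurable_id.prodMk measurable_const)) measurableSet_Iio

lemma IsPeriodicMetric.preimage_inv_mul_oball (hd : IsPeriodicMetric d) (y : G) (r : ℝ) :
    (fun t => y⁻¹ * t) ⁻¹' oball d r = {t | d t y < r} :=
  Set.ext fun t => by
    change d (y⁻¹ * t) 1 < r ↔ d t y < r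
    rw [hd.dist_inv_mul_one]

section Translation

variable [IsTopologicalGroup G] [BorelSpace G] [μ.IsMulLeftInvariant]

lemma IsPeriodicMetric.measure_dist_lt (hd : IsPeriodicMetric d) (y : G) (r : ℝ) :
    μ {t | d t y < r} = μ (oball d r) := by
  rw [← hd.preimage_inv_mul_oball, measure_preimage_mul]

lemma IsPeriodicMetric.setIntegral_dist_lt (hd : IsPeriodicMetric d) (F : G → ℝ) (y : G) (r : ℝ) :
    ∫ t in {t | d t y < r}, F (y⁻¹ * t) ∂μ = ∫ x in oball d r, F x ∂μ := by
  rw [← hd.preimage_inv_mul_oball]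
  exact (measurePreserving_mul_left μ y⁻¹).setIntegral_preimage_emb
    (measurableEmbedding_mulLeft y⁻¹) F _

lemma IsBessel.card_mul_setIntegral_le [IsFiniteMeasureOnCompacts μ] {ι : Type*} {p : ι → G}
    (hp : IsBessel π g p B) (hd : IsPeriodicMetric d)
    (hint : Integrable (fun x => ‖coeff π g g x‖ ^ 2) μ) (R : ℝ) {y : G} {u : Finset ι}
    (hu : ∀ i ∈ u, d (p i) y < ρ) :
    u.card * ∫ x in oball d R, ‖coeff π g g x‖ ^ 2 ∂μ
      ≤ B * ‖g‖ ^ 2 * μ.real (oball d (R + ρ)) := by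
  set F : G → ℝ := fun x => ‖coeff π g g x‖ ^ 2
  set T : Set G := {t | d t y < R + ρ}
  have hTtop : μ T ≠ ⊤ := (hd.measure_dist_lt y _).trans_ne (hd.measure_oball_lt_top μ _).ne
  have hF (i : ι) : Integrable (fun t => F ((p i)⁻¹ * t)) μ := hint.comp_mul_left (p i)⁻¹
  have hterm : ∀ i ∈ u, ∫ x in oball d R, F x ∂μ ≤ ∫ t in T, F ((p i)⁻¹ * t) ∂μ := by
    intro i hi
    rw [← hd.setIntegral_dist_lt F (p i)]
    refine setIntegral_mono_set (hF i).integrableOn (ae_of_all _ fun t => sq_nonneg _)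
      (LE.le.eventuallyLE fun t ht => ?_)
    exact (hd.triangle t (p i) y).trans_lt (add_lt_add ht (hu i hi))
  calc u.card * ∫ x in oball d R, F x ∂μ = ∑ _ ∈ u, ∫ x in oball d R, F x ∂μ := by
        rw [Finset.sum_const, nsmul_eq_mul]
    _ ≤ ∑ i ∈ u, ∫ t in T, F ((p i)⁻¹ * t) ∂μ := Finset.sum_le_sum hterm
    _ = ∫ t in T, ∑ i ∈ u, F ((p i)⁻¹ * t) ∂μ :=
        (integral_finsetSum _ fun i _ => (hF i).integrableOn).symm
    _ ≤ ∫ _ in T, B * ‖g‖ ^ 2 ∂μ := by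
        refine setIntegral_mono (integrable_finsetSum _ fun i _ => (hF i).integrableOn)
          (integrableOn_const hTtop) fun t => ?_
        simp only [F, ← norm_coeff_op_right_symm]
        exact (hp (π.op t g) u).trans_eq (by rw [LinearIsometryEquiv.norm_map])
    _ = B * ‖g‖ ^ 2 * μ.real (oball d (R + ρ)) := by
        rw [setIntegral_const, smul_eq_mul, mul_comm, measureReal_def, hd.measure_dist_lt,
          measureReal_def]

lemma IsDiscreteSeries.exists_card_le_of_isBessel [CompleteSpace H] [IsFiniteMeasureOnCompacts μ]
    [μ.IsInvInvariant] [NeZero μ] (hπ : IsDiscreteSeries π μ) (hd : IsPeriodicMetric d)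
    (hg : g ≠ 0) (B ρ : ℝ) :
    ∃ N : ℝ, ∀ {ι : Type*} {p : ι → G}, IsBessel π g p B → ∀ (y : G) (u : Finset ι),
      (∀ i ∈ u, d (p i) y < ρ) → (u.card : ℝ) ≤ N := by
  have hpos : 0 < ∫ x, ‖coeff π g g x‖ ^ 2 ∂μ := by
    have := hπ.formalDegree_pos
    have := norm_pos_iff.2 hg
    rw [hπ.integral_norm_sq_coeff]
    positivity
  have hint := hπ.integrable_norm_sq_coeff g g
  obtain ⟨R, hR⟩ := hd.exists_setIntegral_oball_pos hint hpos
  exact ⟨_, fun hp y u hu => (le_div_iff₀ hR).2 (hp.card_mul_setIntegral_le hd hint R hu)⟩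

end Translation

lemma IsPeriodicMetric.polyWeight_nonneg (hd : IsPeriodicMetric d) (α : ℝ) (x : G) :
    0 ≤ polyWeight d α x :=
  Real.rpow_nonneg (by linarith [hd.nonneg x 1]) α

section Tail

variable {Q : Set G}

lemma integrable_norm_sq_coeff_mul_polyWeight (hd : IsPeriodicMetric d) (h1 : (1 : G) ∈ Q)
    (hg : g ∈ localizedVectors π μ Q (polyWeight d α)) :
    Integrable (fun x => ‖coeff π g g x‖ ^ 2 * polyWeight d α x) μ := by
  refine ⟨(((stronglyMeasurable_coeff π g g).norm.measurable.pow_const 2).mul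
    ((hd.measurable_dist_one.const_add 1).pow_const α)).aestronglyMeasurable, ?_⟩
  rw [hasFiniteIntegral_iff_ofReal (ae_of_all _ fun x =>
    mul_nonneg (sq_nonneg _) (hd.polyWeight_nonneg α x))]
  refine (lintegral_mono fun x => ?_).trans_lt hg
  rw [ENNReal.ofReal_mul (sq_nonneg _), ENNReal.ofReal_pow (norm_nonneg _), ofReal_norm]
  gcongr
  simpa using enorm_le_localMax (coeff π g g) x h1

lemma setIntegral_norm_sq_coeff_le (hd : IsPeriodicMetric d) (h1 : (1 : G) ∈ Q) (hα : 0 ≤ α)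
    (hg : g ∈ localizedVectors π μ Q (polyWeight d α)) (hs : 0 < s) :
    ∫ x in {x | s ≤ d x 1}, ‖coeff π g g x‖ ^ 2 ∂μ
      ≤ (∫ x, ‖coeff π g g x‖ ^ 2 * polyWeight d α x ∂μ) * s ^ (-α) := by
  have hint := integrable_norm_sq_coeff_mul_polyWeight hd h1 hg
  have hw (x : G) : 0 ≤ ‖coeff π g g x‖ ^ 2 * polyWeight d α x :=
    mul_nonneg (sq_nonneg _) (hd.polyWeight_nonneg α x)
  rw [Real.rpow_neg hs.le, ← div_eq_mul_inv, le_div_iff₀ (by positivity), ← integral_mul_const]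
  refine le_trans ?_ (setIntegral_le_integral (s := {x | s ≤ d x 1}) hint (ae_of_all _ hw))
  refine integral_mono_of_nonneg (ae_of_all _ fun x => by positivity) hint.integrableOn ?_
  refine (ae_restrict_iff' (hd.measurable_dist_one measurableSet_Ici)).2
    (ae_of_all _ fun x hx => ?_)
  have hsx : s ≤ 1 + d x 1 := hx.trans (le_add_of_nonneg_left zero_le_one)
  exact mul_le_mul_of_nonneg_left (Real.rpow_le_rpow hs.le hsx hα) (sq_nonneg _)

end Tail

section LocalMaximum

variable {Q : Set G} {p t y : G}

lemma enorm_coeff_op_le_localMax (π : ProjectiveRep G H) (g : H) (hQ : Q⁻¹ = Q)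
    (h : p⁻¹ * t * y ∈ Q) : ‖coeff π g (π.op t g) p‖ₑ ≤ localMax Q (coeff π g g) y := by
  have hz : (p⁻¹ * t * y)⁻¹ ∈ Q := by
    rw [← hQ]
    exact Set.inv_mem_inv.2 h
  have hyz : y * (p⁻¹ * t * y)⁻¹ = t⁻¹ * p := by group
  rw [← ofReal_norm, norm_coeff_op_right, ofReal_norm, ← hyz]
  exact enorm_le_localMax _ y hz

lemma IsPeriodicMetric.rpow_le_mul_polyWeight (hd : IsPeriodicMetric d) (hα : 0 ≤ α) (hs : 0 ≤ s)
    (hfar : s ≤ d p t) (hnear : d (p⁻¹ * t * y) 1 < ρ) :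
    s ^ α ≤ (1 + ρ) ^ α * polyWeight d α y := by
  have hy := hd.nonneg y 1
  have hρ : 0 < ρ := (hd.nonneg _ _).trans_lt hnear
  have hsy : s ≤ (1 + ρ) * (1 + d y 1) := by
    have hdist : d p t ≤ d (p⁻¹ * t * y) 1 + d y 1 := by
      have h := hd.dist_mul_one_le (p⁻¹ * t * y) y⁻¹
      rwa [mul_inv_cancel_right, hd.dist_inv_mul_one, hd.symm t, hd.dist_inv_one] at h
    nlinarith
  rw [polyWeight, ← Real.mul_rpow (by positivity) (by positivity)]
  exact Real.rpow_le_rpow hs hsy hα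

lemma enorm_sq_coeff_op_mul_le (hd : IsPeriodicMetric d) (π : ProjectiveRep G H) (g : H)
    (hQ : Q⁻¹ = Q) (hQρ : Q ⊆ oball d ρ) (hα : 0 ≤ α) (hs : 0 ≤ s) (hfar : s ≤ d p t)
    (h : p⁻¹ * t * y ∈ Q) :
    ‖coeff π g (π.op t g) p‖ₑ ^ 2 * ENNReal.ofReal (s ^ α) ≤ ENNReal.ofReal ((1 + ρ) ^ α) *
      (localMax Q (coeff π g g) y ^ 2 * ENNReal.ofReal (polyWeight d α y)) := by
  have hρ : 0 < ρ := (hd.nonneg _ _).trans_lt (hQρ h)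
  calc _ ≤ localMax Q (coeff π g g) y ^ 2 * ENNReal.ofReal ((1 + ρ) ^ α * polyWeight d α y) := by
        gcongr
        · exact enorm_coeff_op_le_localMax π g hQ h
        · exact hd.rpow_le_mul_polyWeight hα hs hfar (hQρ h)
    _ = _ := by rw [ENNReal.ofReal_mul (by positivity), mul_left_comm]

lemma sum_enorm_sq_coeff_op_mul_indicator_le (hd : IsPeriodicMetric d) (π : ProjectiveRep G H)
    (g : H) (hQ : Q⁻¹ = Q) (hQρ : Q ⊆ oball d ρ) (hα : 0 ≤ α) {ι : Type*} {u : Finset ι}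
    {p : ι → G} {N : ℝ≥0∞}
    (hcard : ∀ (y : G), ∀ w : Finset ι, (∀ i ∈ w, d (p i) y < ρ) → w.card ≤ N)
    (hs : 0 ≤ s) (hfar : ∀ i ∈ u, s ≤ d (p i) t) (y : G) :
    ∑ i ∈ u, ‖coeff π g (π.op t g) (p i)‖ₑ ^ 2 * ENNReal.ofReal (s ^ α) *
        Q.indicator 1 ((p i)⁻¹ * t * y)
      ≤ N * (ENNReal.ofReal ((1 + ρ) ^ α) *
        (localMax Q (coeff π g g) y ^ 2 * ENNReal.ofReal (polyWeight d α y))) := by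
  classical
  set w := u.filter fun i => (p i)⁻¹ * t * y ∈ Q
  have hw : ∀ i ∈ w, i ∈ u ∧ (p i)⁻¹ * t * y ∈ Q := fun i => Finset.mem_filter.1
  have hnear : ∀ i ∈ w, d (p i) (t * y) < ρ := fun i hi => by
    have h : d ((p i)⁻¹ * t * y) 1 < ρ := hQρ (hw i hi).2
    rwa [mul_assoc, hd.dist_inv_mul_one, hd.symm] at h
  calc ∑ i ∈ u, ‖coeff π g (π.op t g) (p i)‖ₑ ^ 2 * ENNReal.ofReal (s ^ α) *
        Q.indicator 1 ((p i)⁻¹ * t * y)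
      = ∑ i ∈ w, ‖coeff π g (π.op t g) (p i)‖ₑ ^ 2 * ENNReal.ofReal (s ^ α) := by
        rw [Finset.sum_filter]
        exact Finset.sum_congr rfl fun i _ => by simp [Set.indicator_apply]
    _ ≤ w.card • _ := Finset.sum_le_card_nsmul _ _ _ fun i hi =>
        enorm_sq_coeff_op_mul_le hd π g hQ hQρ hα hs (hfar i (hw i hi).1) (hw i hi).2
    _ ≤ _ := by
        rw [nsmul_eq_mul]
        gcongr
        exact hcard (t * y) w hnear

variable [IsTopologicalGroup G] [BorelSpace G] [μ.IsMulLeftInvariant]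

lemma sum_enorm_sq_coeff_op_mul_measure_le (hd : IsPeriodicMetric d) (π : ProjectiveRep G H)
    (g : H) (hQ : Q⁻¹ = Q) (hQρ : Q ⊆ oball d ρ) (hQm : MeasurableSet Q) (hα : 0 ≤ α) {ι : Type*}
    {u : Finset ι} {p : ι → G} {N : ℝ≥0∞} (hN : N ≠ ⊤)
    (hcard : ∀ (y : G), ∀ w : Finset ι, (∀ i ∈ w, d (p i) y < ρ) → w.card ≤ N)
    (hs : 0 ≤ s) (hfar : ∀ i ∈ u, s ≤ d (p i) t) :
    (∑ i ∈ u, ‖coeff π g (π.op t g) (p i)‖ₑ ^ 2) * ENNReal.ofReal (s ^ α) * μ Q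
      ≤ N * (ENNReal.ofReal ((1 + ρ) ^ α) *
        ∫⁻ x, localMax Q (coeff π g g) x ^ 2 * ENNReal.ofReal (polyWeight d α x) ∂μ) := by
  have hmeas (i : ι) : Measurable fun y : G => Q.indicator (1 : G → ℝ≥0∞) ((p i)⁻¹ * t * y) :=
    (measurable_one.indicator hQm).comp (measurable_const_mul _)
  have htrans (i : ι) : ∫⁻ y, Q.indicator 1 ((p i)⁻¹ * t * y) ∂μ = μ Q := by
    rw [lintegral_mul_left_eq_self (μ := μ) (Q.indicator 1) ((p i)⁻¹ * t),
      lintegral_indicator_one hQm]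
  rw [← lintegral_const_mul' _ _ ENNReal.ofReal_ne_top, ← lintegral_const_mul' _ _ hN]
  refine le_trans (le_of_eq ?_) (lintegral_mono
    (sum_enorm_sq_coeff_op_mul_indicator_le hd π g hQ hQρ hα hcard hs hfar))
  rw [lintegral_finsetSum _ fun i _ => (hmeas i).const_mul _, Finset.sum_mul, Finset.sum_mul]
  exact Finset.sum_congr rfl fun i _ => by rw [lintegral_const_mul _ (hmeas i), htrans]

theorem IsDiscreteSeries.exists_tsum_coeff_le [CompleteSpace H] [μ.IsOpenPosMeasure]
    [IsFiniteMeasureOnCompacts μ] [μ.IsInvInvariant] [NeZero μ] (hπ : IsDiscreteSeries π μ)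
    (hd : IsPeriodicMetric d) (hg : g ≠ 0) (hQ : IsAdmissibleNhd Q) (hQo : IsOpen Q) (hα : 0 ≤ α)
    (hgQ : g ∈ localizedVectors π μ Q (polyWeight d α)) (B : ℝ) :
    ∃ C : ℝ, 0 ≤ C ∧ ∀ {ι : Type*} {p : ι → G}, IsBessel π g p B → ∀ (t : G) (s : ℝ), 0 < s →
      (∀ i, s ≤ d (p i) t) → ∑' i, ‖coeff π g (π.op t g) (p i)‖ ^ 2 ≤ C * s ^ (-α) := by
  obtain ⟨ρ, _, hQρ⟩ := hd.exists_subset_oball hQ.2.1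
  obtain ⟨N, hcard⟩ := hπ.exists_card_le_of_isBessel hd hg B ρ
  set M := ∫⁻ x, localMax Q (coeff π g g) x ^ 2 * ENNReal.ofReal (polyWeight d α x) ∂μ
  have hQpos : μ Q ≠ 0 := (hQo.measure_pos μ ⟨1, mem_of_mem_nhds hQ.1⟩).ne'
  have hQtop : μ Q ≠ ⊤ := ((measure_mono subset_closure).trans_lt hQ.2.1.measure_lt_top).ne
  set K := ENNReal.ofReal N * (ENNReal.ofReal ((1 + ρ) ^ α) * M) / μ Q
  have hK : K ≠ ⊤ := ENNReal.div_ne_top (ENNReal.mul_ne_top ENNReal.ofReal_ne_top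
    (ENNReal.mul_ne_top ENNReal.ofReal_ne_top hgQ.ne)) hQpos
  refine ⟨K.toReal, ENNReal.toReal_nonneg, fun {ι p} hp t s hs hfar =>
    tsum_le_of_sum_le' (by positivity) fun u => ?_⟩
  have hsum := sum_enorm_sq_coeff_op_mul_measure_le (μ := μ) hd π g hQ.2.2
    (subset_closure.trans hQρ) hQo.measurableSet hα ENNReal.ofReal_ne_top
    (fun y w hw => by simpa using ENNReal.ofReal_le_ofReal (hcard hp y w hw)) hs.le
    fun i (_ : i ∈ u) => hfar i
  rw [← ENNReal.le_div_iff_mul_le (Or.inl hQpos) (Or.inl hQtop)] at hsum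
  have hreal := ENNReal.toReal_mono hK hsum
  rw [ENNReal.toReal_mul, ENNReal.toReal_ofReal (by positivity),
    ENNReal.toReal_sum fun i _ => ENNReal.pow_ne_top enorm_ne_top] at hreal
  rw [Real.rpow_neg hs.le, ← div_eq_mul_inv, le_div_iff₀ (by positivity)]
  simpa using hreal

end LocalMaximum

lemma localizedVectors_anti (π : ProjectiveRep G H) (w : G → ℝ) {P Q : Set G} (h : P ⊆ Q) :
    localizedVectors π μ Q w ⊆ localizedVectors π μ P w := fun g hg =>
  (lintegral_mono fun x => by
    gcongr
    exact biSup_mono h).trans_lt hg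

end Estimates

/-! ### Comparison of counting functions with volumes of balls -/

section Comparison

variable {G : Type*} [Group G] [TopologicalSpace G] [MeasurableSpace G] [IsTopologicalGroup G]
  [BorelSpace G] {μ : Measure G} [μ.IsMulLeftInvariant] {d : G → G → ℝ}
  {H : Type*} [NormedAddCommGroup H] [InnerProductSpace ℂ H] {π : ProjectiveRep G H} {g : H}
  {α A B : ℝ} {Q : Set G}

lemma setIntegral_compl_norm_sq_coeff_op_le (hd : IsPeriodicMetric d)
    (hint : Integrable (fun x => ‖coeff π g g x‖ ^ 2) μ) {l x : G} {R s : ℝ} (hl : d l x < R) :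
    ∫ t in {t | d t x < R + s}ᶜ, ‖coeff π g (π.op t g) l‖ ^ 2 ∂μ
      ≤ ∫ t in {t | s ≤ d t 1}, ‖coeff π g g t‖ ^ 2 ∂μ := by
  have hpre : (fun t => l⁻¹ * t) ⁻¹' {t | s ≤ d t 1} = {t | s ≤ d t l} := by
    ext t
    simp only [Set.mem_preimage, Set.mem_ofPred_eq, hd.dist_inv_mul_one]
  rw [← (measurePreserving_mul_left μ l⁻¹).setIntegral_preimage_emb
    (measurableEmbedding_mulLeft l⁻¹) (fun t => ‖coeff π g g t‖ ^ 2), hpre]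
  simp only [norm_coeff_op_right_symm]
  refine setIntegral_mono_set (hint.comp_mul_left l⁻¹).integrableOn
    (ae_of_all _ fun t => sq_nonneg _) (LE.le.eventuallyLE fun t ht => ?_)
  have htx : R + s ≤ d t x := not_lt.1 ht
  change s ≤ d t l
  linarith [hd.triangle t l x]

variable [μ.IsInvInvariant] [NeZero μ] [CompleteSpace H]
  {W : Submodule ℂ H} [FiniteDimensional ℂ W] {ι : Type*} {S : Finset ι} {p : ι → G}
  {x : G} {R s : ℝ}

lemma IsDiscreteSeries.mul_setIntegral_compl_norm_sq_starProjection_op_le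
    (hπ : IsDiscreteSeries π μ) (hd : IsPeriodicMetric d)
    (hW : ∀ v, A * ‖W.starProjection v‖ ^ 2 ≤ ∑ i ∈ S, ‖coeff π g v (p i)‖ ^ 2)
    (hp : ∀ i ∈ S, d (p i) x < R) :
    A * ∫ t in {t | d t x < R + s}ᶜ, ‖W.starProjection (π.op t g)‖ ^ 2 ∂μ
      ≤ S.card * ∫ t in {t | s ≤ d t 1}, ‖coeff π g g t‖ ^ 2 ∂μ := by
  set T : Set G := {t | d t x < R + s}
  have hcoeff := hπ.integrable_norm_sq_coeff g g
  have hcoeff_op (i : ι) : Integrable (fun t => ‖coeff π g (π.op t g) (p i)‖ ^ 2) μ := by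
    simpa only [norm_coeff_op_right_symm] using hcoeff.comp_mul_left (p i)⁻¹
  calc _ = ∫ t in Tᶜ, A * ‖W.starProjection (π.op t g)‖ ^ 2 ∂μ := (integral_const_mul _ _).symm
    _ ≤ ∫ t in Tᶜ, ∑ i ∈ S, ‖coeff π g (π.op t g) (p i)‖ ^ 2 ∂μ :=
        setIntegral_mono ((hπ.integrable_norm_sq_starProjection_op g W).const_mul A).integrableOn
          (integrable_finsetSum _ fun i _ => (hcoeff_op i).integrableOn) fun t => hW _
    _ = ∑ i ∈ S, ∫ t in Tᶜ, ‖coeff π g (π.op t g) (p i)‖ ^ 2 ∂μ :=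
        integral_finsetSum _ fun i _ => (hcoeff_op i).integrableOn
    _ ≤ _ := by
        rw [← nsmul_eq_mul]
        exact Finset.sum_le_card_nsmul _ _ _ fun i hi =>
          setIntegral_compl_norm_sq_coeff_op_le hd hcoeff (hp i hi)

variable [IsFiniteMeasureOnCompacts μ]

lemma IsDiscreteSeries.mul_measure_oball_le_finrank (hπ : IsDiscreteSeries π μ)
    (hd : IsPeriodicMetric d) (hg : g ≠ 0) {κ : ℝ}
    (hκ : ∀ t, d t x < R → ‖g‖ ^ 2 * κ ≤ ‖W.starProjection (π.op t g)‖ ^ 2) :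
    formalDegree π μ * (μ.real (oball d R) * κ) ≤ Module.finrank ℂ W := by
  have hpos := hπ.formalDegree_pos
  have hg0 : 0 < ‖g‖ ^ 2 := pow_pos (norm_pos_iff.2 hg) 2
  have htop : μ {t | d t x < R} ≠ ⊤ := (hd.measure_dist_lt x R).trans_ne
    (hd.measure_oball_lt_top μ R).ne
  have hint := hπ.integrable_norm_sq_starProjection_op g W
  have hle : μ.real (oball d R) * (‖g‖ ^ 2 * κ)
      ≤ (formalDegree π μ)⁻¹ * ‖g‖ ^ 2 * Module.finrank ℂ W := by
    calc μ.real (oball d R) * (‖g‖ ^ 2 * κ) = ∫ _ in {t | d t x < R}, ‖g‖ ^ 2 * κ ∂μ := by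
          rw [setIntegral_const, smul_eq_mul, measureReal_def, measureReal_def,
            hd.measure_dist_lt]
      _ ≤ ∫ t in {t | d t x < R}, ‖W.starProjection (π.op t g)‖ ^ 2 ∂μ :=
          setIntegral_mono_on (integrableOn_const htop) hint.integrableOn
            (hd.measurableSet_dist_lt x R) hκ
      _ ≤ ∫ t, ‖W.starProjection (π.op t g)‖ ^ 2 ∂μ :=
          setIntegral_le_integral hint (ae_of_all _ fun t => sq_nonneg _)
      _ = _ := hπ.integral_norm_sq_starProjection_op g W
  rw [inv_mul_eq_div, div_mul_eq_mul_div, le_div_iff₀' hpos] at hle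
  refine le_of_mul_le_mul_left ?_ hg0
  linarith

theorem IsDiscreteSeries.exists_le_card_of_isFrame [μ.IsOpenPosMeasure] (hπ : IsDiscreteSeries π μ)
    (hd : IsPeriodicMetric d) (hg : g ≠ 0) (hQ : IsAdmissibleNhd Q) (hQo : IsOpen Q) (hα : 0 ≤ α)
    (hgQ : g ∈ localizedVectors π μ Q (polyWeight d α)) (hA : 0 < A) (B : ℝ) :
    ∃ C : ℝ, 0 ≤ C ∧ ∀ Λ : Set G, IsFrame π g Λ A B → ∀ (x : G) (R s : ℝ), 0 < s →
      ∀ S : Finset Λ, (∀ l : Λ, d l x < R → l ∈ S) →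
        formalDegree π μ * (μ.real (oball d (R - s)) * (1 - C * s ^ (-α))) ≤ S.card := by
  obtain ⟨C, hC0, hC⟩ := hπ.exists_tsum_coeff_le hd hg hQ hQo hα hgQ B
  refine ⟨C / (A * ‖g‖ ^ 2), by positivity, fun Λ hF x R s hs S hS => ?_⟩
  obtain ⟨W, _, hdim, hW⟩ := hF.exists_subspace hA S
  refine (hπ.mul_measure_oball_le_finrank hd hg (x := x) fun t ht => ?_).trans
    (Nat.cast_le.2 hdim)
  have hfar (l : ↥((S : Set Λ)ᶜ)) : s ≤ d (l : Λ) t := by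
    have hl : R ≤ d (l : Λ) x := not_lt.1 fun h => l.2 (hS l h)
    linarith [hd.triangle (l : Λ) t x]
  have htail := (hW (π.op t g)).trans
    (hC (hF.isBessel.comp_injective Subtype.val_injective) t s hs hfar)
  rw [LinearIsometryEquiv.norm_map, ← le_div_iff₀' hA] at htail
  have hg0 : ‖g‖ ≠ 0 := norm_ne_zero_iff.2 hg
  have hscale : ‖g‖ ^ 2 * (1 - C / (A * ‖g‖ ^ 2) * s ^ (-α)) = ‖g‖ ^ 2 - C * s ^ (-α) / A := by
    field_simp
  linarith

lemma IsDiscreteSeries.setIntegral_norm_sq_starProjection_op_le (hπ : IsDiscreteSeries π μ)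
    (hd : IsPeriodicMetric d) (g : H) (W : Submodule ℂ H) [FiniteDimensional ℂ W] (x : G) (R : ℝ) :
    ∫ t in {t | d t x < R}, ‖W.starProjection (π.op t g)‖ ^ 2 ∂μ
      ≤ ‖g‖ ^ 2 * μ.real (oball d R) := by
  have htop : μ {t | d t x < R} ≠ ⊤ := (hd.measure_dist_lt x _).trans_ne
    (hd.measure_oball_lt_top μ _).ne
  calc _ ≤ ∫ _ in {t | d t x < R}, ‖g‖ ^ 2 ∂μ :=
        setIntegral_mono (hπ.integrable_norm_sq_starProjection_op g W).integrableOn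
          (integrableOn_const htop) fun t => pow_le_pow_left₀ (norm_nonneg _)
            ((W.norm_starProjection_apply_le _).trans_eq (LinearIsometryEquiv.norm_map _ _)) 2
    _ = _ := by
        rw [setIntegral_const, smul_eq_mul, mul_comm, measureReal_def, measureReal_def,
          hd.measure_dist_lt]

lemma IsDiscreteSeries.finrank_le (hπ : IsDiscreteSeries π μ) (hd : IsPeriodicMetric d)
    (hA : 0 < A) (hW : ∀ v, A * ‖W.starProjection v‖ ^ 2 ≤ ∑ i ∈ S, ‖coeff π g v (p i)‖ ^ 2)
    (hp : ∀ i ∈ S, d (p i) x < R) :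
    (formalDegree π μ)⁻¹ * ‖g‖ ^ 2 * Module.finrank ℂ W ≤ ‖g‖ ^ 2 * μ.real (oball d (R + s))
      + S.card * (∫ t in {t | s ≤ d t 1}, ‖coeff π g g t‖ ^ 2 ∂μ) / A := by
  rw [← hπ.integral_norm_sq_starProjection_op g W,
    ← integral_add_compl (hd.measurableSet_dist_lt x (R + s))
      (hπ.integrable_norm_sq_starProjection_op g W)]
  exact add_le_add (hπ.setIntegral_norm_sq_starProjection_op_le hd g W x (R + s))
    ((le_div_iff₀' hA).2 (hπ.mul_setIntegral_compl_norm_sq_starProjection_op_le hd hW hp))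

theorem IsDiscreteSeries.exists_card_le_of_isRieszSequence (hπ : IsDiscreteSeries π μ)
    (hd : IsPeriodicMetric d) (hg : g ≠ 0) (h1 : (1 : G) ∈ Q) (hα : 0 ≤ α)
    (hgQ : g ∈ localizedVectors π μ Q (polyWeight d α)) (hA : 0 < A) :
    ∃ C : ℝ, 0 ≤ C ∧ ∀ (Λ : Set G) (B : ℝ), IsRieszSequence π g Λ A B → ∀ (x : G) (R s : ℝ),
      0 < s → ∀ S : Finset Λ, (∀ l ∈ S, d (l : G) x < R) →
        S.card * (1 - C * s ^ (-α)) ≤ formalDegree π μ * μ.real (oball d (R + s)) := by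
  have hpos := hπ.formalDegree_pos
  have : 0 < ‖g‖ := norm_pos_iff.2 hg
  set M := ∫ x, ‖coeff π g g x‖ ^ 2 * polyWeight d α x ∂μ
  have hM : 0 ≤ M := integral_nonneg fun x => mul_nonneg (sq_nonneg _) (hd.polyWeight_nonneg α x)
  refine ⟨formalDegree π μ * M / (A * ‖g‖ ^ 2), by positivity, fun Λ B hR x R s hs S hS => ?_⟩
  obtain ⟨W, _, hdim, hW⟩ := hR.exists_subspace hA S
  have hle := (hπ.finrank_le hd hA hW (s := s) hS).trans (add_le_add_right
    (div_le_div_of_nonneg_right (mul_le_mul_of_nonneg_left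
      (setIntegral_norm_sq_coeff_le hd h1 hα hgQ hs) (Nat.cast_nonneg _)) hA.le) _)
  rw [hdim] at hle
  refine le_of_mul_le_mul_left ?_ (show 0 < (formalDegree π μ)⁻¹ * ‖g‖ ^ 2 by positivity)
  calc _ = (formalDegree π μ)⁻¹ * ‖g‖ ^ 2 * S.card - S.card * (M * s ^ (-α)) / A := by
        field_simp
    _ ≤ ‖g‖ ^ 2 * μ.real (oball d (R + s)) := sub_le_iff_le_add.2 hle
    _ = _ := by field_simp

end Comparison

/-! ### Asymptotics of counting ratios -/

section Asymptotics

variable {α δ : ℝ}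

lemma rpow_scale_rpow_neg {r : ℝ} (hr : 0 ≤ r) (α δ : ℝ) :
    (r ^ (δ / (δ + α))) ^ (-α) = r ^ (-(α * δ / (δ + α))) := by
  rw [← Real.rpow_mul hr]
  congr 1
  ring

lemma eventually_div_rpow_le (hα : 0 < α) (hδ : 0 < δ) (hδ1 : δ ≤ 1) (ρ : ℝ) :
    ∀ᶠ r : ℝ in atTop, ∀ a t, r ≤ a → 0 ≤ t → t ≤ r ^ (δ / (δ + α)) + ρ →
      t ≤ a ∧ (t / a) ^ δ ≤ 2 * r ^ (-(α * δ / (δ + α))) := by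
  have hθ : 0 < δ / (δ + α) := by positivity
  have hθ1 : 0 < 1 - δ / (δ + α) := by
    rw [sub_pos, div_lt_one (by positivity)]
    linarith
  filter_upwards [eventually_gt_atTop 0, (tendsto_rpow_atTop hθ).eventually_ge_atTop ρ,
    (tendsto_rpow_atTop hθ1).eventually_ge_atTop 2] with r hr hρ htwo a t hra ht0 ht
  have ht2 : t ≤ 2 * r ^ (δ / (δ + α)) := by linarith
  constructor
  · calc t ≤ r ^ (1 - δ / (δ + α)) * r ^ (δ / (δ + α)) := ht2.trans (by gcongr)
      _ = r := by rw [← Real.rpow_add hr, sub_add_cancel, Real.rpow_one]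
      _ ≤ a := hra
  · have ha : 0 < a := hr.trans_le hra
    calc (t / a) ^ δ ≤ (2 * r ^ (δ / (δ + α)) / r) ^ δ := by gcongr
      _ = 2 ^ δ * r ^ (-(α * δ / (δ + α))) := by
          rw [mul_div_assoc, ← Real.rpow_sub_one hr.ne', Real.mul_rpow zero_le_two (by positivity),
            ← Real.rpow_mul hr.le]
          congr 2
          field_simp
          ring
      _ ≤ 2 * r ^ (-(α * δ / (δ + α))) := by
          gcongr
          exact (Real.rpow_le_rpow_of_exponent_le one_le_two hδ1).trans_eq (Real.rpow_one 2)

lemma eventually_mul_rpow_neg_le_half {η : ℝ} (hη : 0 < η) (κ : ℝ) :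
    ∀ᶠ r : ℝ in atTop, κ * r ^ (-η) ≤ 1 / 2 := by
  have hlim := (tendsto_rpow_neg_atTop hη).const_mul κ
  rw [mul_zero] at hlim
  exact hlim.eventually_le_const one_half_pos

lemma one_sub_mul_le_of_mul_one_sub_le {K V v a b : ℝ} (hKV : K ≤ V) (hV : 0 ≤ V)
    (ha : 0 ≤ a) (hb : 0 ≤ b) (hab : a + b ≤ 1) (hv : V * (1 - a) ≤ v) :
    (1 - (a + b)) * K ≤ v * (1 - b) := by
  calc (1 - (a + b)) * K ≤ (1 - (a + b)) * V := by gcongr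
    _ ≤ V * (1 - a) * (1 - b) := by nlinarith [mul_nonneg hV (mul_nonneg ha hb)]
    _ ≤ v * (1 - b) := mul_le_mul_of_nonneg_right hv (by linarith)

lemma le_one_add_mul_of_mul_one_sub_le {N M V K a b : ℝ} (hN : 0 ≤ N) (hM : 0 ≤ M) (ha : 0 ≤ a)
    (hb : 0 ≤ b) (hab : a + b ≤ 1 / 2) (hNV : N * (1 - b) ≤ M * V) (hVK : V * (1 - a) ≤ K) :
    N ≤ M * (1 + 2 * (a + b)) * K := by
  have hlower : N * (1 - (a + b)) ≤ M * K := by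
    calc N * (1 - (a + b)) ≤ N * (1 - b) * (1 - a) := by
          nlinarith [mul_nonneg hN (mul_nonneg ha hb)]
      _ ≤ M * V * (1 - a) := mul_le_mul_of_nonneg_right hNV (by linarith)
      _ = M * (V * (1 - a)) := mul_assoc _ _ _
      _ ≤ M * K := by gcongr
  have hinv : 1 ≤ (1 - (a + b)) * (1 + 2 * (a + b)) := by nlinarith
  calc N ≤ N * ((1 - (a + b)) * (1 + 2 * (a + b))) := le_mul_of_one_le_right hN hinv
    _ = N * (1 - (a + b)) * (1 + 2 * (a + b)) := (mul_assoc _ _ _).symm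
    _ ≤ M * K * (1 + 2 * (a + b)) := by gcongr
    _ = M * (1 + 2 * (a + b)) * K := by ring

variable {G : Type*} [Group G] [TopologicalSpace G] [MeasurableSpace G] {d : G → G → ℝ}
  {μ : Measure G}

lemma IsPeriodicMetric.mem_smul_oball (hd : IsPeriodicMetric d) (x y : G) (r : ℝ) :
    y ∈ x • oball d r ↔ d y x < r := by
  rw [Set.mem_smul_set_iff_inv_smul_mem, smul_eq_mul, ← hd.dist_inv_mul_one]
  rfl

lemma measure_closure_oball_ne_zero [μ.IsOpenPosMeasure] {r ρ : ℝ}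
    (hρ : oball d ρ ∈ 𝓝 (1 : G)) (hr : ρ ≤ r) :
    μ (closure (oball d r)) ≠ 0 :=
  (Measure.measure_pos_of_mem_nhds μ (mem_of_superset hρ fun _ hx =>
    subset_closure (lt_of_lt_of_le hx hr))).ne'

lemma AnnularDecay.exists_measureReal_oball_le [IsFiniteMeasureOnCompacts μ]
    (hδ : AnnularDecay μ d δ) (hd : IsPeriodicMetric d) :
    ∃ c : ℝ, 0 < c ∧ ∀ r s : ℝ, 1 ≤ r → 0 < s → s ≤ r →
      μ.real (oball d r) * (1 - c * (s / r) ^ δ) ≤ μ.real (oball d (r - s)) := by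
  obtain ⟨-, -, c, hc, h⟩ := hδ
  refine ⟨c, hc, fun r s hr hs hsr => ?_⟩
  have htop (r : ℝ) : μ (oball d r) ≠ ⊤ := (hd.measure_oball_lt_top μ r).ne
  have hsub : oball d (r - s) ⊆ oball d r := fun x hx =>
    lt_of_lt_of_le (show d x 1 < r - s from hx) (by linarith)
  have hreal := ENNReal.toReal_mono (ENNReal.mul_ne_top ENNReal.ofReal_ne_top (htop r))
    (h r s hr hs hsr)
  rw [ENNReal.toReal_mul, ENNReal.toReal_ofReal (by positivity), ← measureReal_def,
    ← measureReal_def, measureReal_sdiff hsub (hd.measurableSet_oball _) (htop _)] at hreal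
  linarith

lemma AnnularDecay.exists_eventually_measureReal_oball_le [IsFiniteMeasureOnCompacts μ]
    (hδ : AnnularDecay μ d δ) (hd : IsPeriodicMetric d) (hα : 0 < α) :
    ∃ c : ℝ, 0 < c ∧ ∀ ρ : ℝ, ∀ᶠ r : ℝ in atTop, ∀ a t, r ≤ a → 0 < t →
      t ≤ r ^ (δ / (δ + α)) + ρ →
        μ.real (oball d a) * (1 - c * r ^ (-(α * δ / (δ + α)))) ≤ μ.real (oball d (a - t)) := by
  obtain ⟨c, hc, h⟩ := hδ.exists_measureReal_oball_le hd
  refine ⟨c * 2, by positivity, fun ρ => ?_⟩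
  filter_upwards [eventually_ge_atTop 1, eventually_div_rpow_le hα hδ.1 hδ.2.1 ρ]
    with r hr hscale a t hra ht0 ht
  obtain ⟨hta, hpow⟩ := hscale a t hra ht0.le ht
  refine le_trans ?_ (h a t (hr.trans hra) ht0 hta)
  rw [mul_assoc]
  gcongr

end Asymptotics

section Counting

variable {ι : Type*} {E : Set ι} {q : ℝ}

lemma ofReal_le_encard (h : ∀ S : Finset ι, E ⊆ S → q ≤ S.card) :
    ENNReal.ofReal q ≤ (E.encard : ℝ≥0∞) := by
  rcases E.finite_or_infinite with hE | hE
  · lift E to Finset ι using hE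
    rw [Set.encard_coe_eq_coe_finsetCard, ENat.toENNReal_coe, ENNReal.ofReal_le_natCast]
    exact h E subset_rfl
  · rw [hE.encard_eq, ENat.toENNReal_top]
    exact le_top

lemma encard_le_ofReal (h : ∀ S : Finset ι, (S : Set ι) ⊆ E → S.card ≤ q) :
    (E.encard : ℝ≥0∞) ≤ ENNReal.ofReal q := by
  rcases E.finite_or_infinite with hE | hE
  · lift E to Finset ι using hE
    rw [Set.encard_coe_eq_coe_finsetCard, ENat.toENNReal_coe, ← ENNReal.ofReal_natCast]
    exact ENNReal.ofReal_le_ofReal (h E subset_rfl)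
  · obtain ⟨n, hn⟩ := exists_nat_gt q
    obtain ⟨S, hSE, rfl⟩ := hE.exists_subset_card_eq n
    exact absurd (h S hSE) hn.not_ge

lemma encard_inter_eq_encard_preimage (Λ T : Set ι) :
    (Λ ∩ T).encard = ((↑) ⁻¹' T : Set Λ).encard := by
  rw [← Subtype.image_preimage_coe, Subtype.val_injective.encard_image]

variable {G : Type*} [Group G] [MeasurableSpace G] {μ : Measure G} {Λ K : Set G} {x : G}

lemma ofReal_le_countingRatio (hK₀ : μ K ≠ 0) (hK : μ K ≠ ⊤)
    (h : ∀ S : Finset Λ, (∀ l : Λ, (l : G) ∈ x • K → l ∈ S) → q * μ.real K ≤ S.card) :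
    ENNReal.ofReal q ≤ countingRatio μ Λ K x := by
  rw [countingRatio, ENNReal.le_div_iff_mul_le (Or.inl hK₀) (Or.inl hK), ← ofReal_measureReal hK,
    ← ENNReal.ofReal_mul' measureReal_nonneg, encard_inter_eq_encard_preimage]
  exact ofReal_le_encard h

lemma countingRatio_le_ofReal (hK : μ K ≠ ⊤)
    (h : ∀ S : Finset Λ, (∀ l ∈ S, (l : G) ∈ x • K) → S.card ≤ q * μ.real K) :
    countingRatio μ Λ K x ≤ ENNReal.ofReal q := by
  refine ENNReal.div_le_of_le_mul ?_
  rw [← ofReal_measureReal hK, ← ENNReal.ofReal_mul' measureReal_nonneg,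
    encard_inter_eq_encard_preimage]
  exact encard_le_ofReal h

end Counting

section Density

variable {G : Type*} [Group G] [TopologicalSpace G] [IsTopologicalGroup G]
  [LocallyCompactSpace G] [MeasurableSpace G] [BorelSpace G] {d : G → G → ℝ}
  {H : Type*} [NormedAddCommGroup H] [InnerProductSpace ℂ H] [CompleteSpace H]
  {μ : Measure G} [μ.IsHaarMeasure] [μ.IsInvInvariant] {π : ProjectiveRep G H} {g : H}
  {α δ A : ℝ} {Q : Set G}

theorem IsDiscreteSeries.exists_ofReal_le_countingRatio (hπ : IsDiscreteSeries π μ)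
    (hd : IsPeriodicMetric d) (hδ : AnnularDecay μ d δ) (hQ : IsAdmissibleNhd Q) (hα : 0 < α)
    (hgQ : g ∈ localizedVectors π μ Q (polyWeight d α)) (hA : 0 < A) (B : ℝ) :
    ∃ C : ℝ, 0 < C ∧ ∀ᶠ r in atTop, ∀ Λ : Set G, IsFrame π g Λ A B →
      ENNReal.ofReal (formalDegree π μ * (1 - C * r ^ (-(α * δ / (δ + α)))))
        ≤ ⨅ x : G, countingRatio μ Λ (closure (oball d r)) x := by
  have := hπ.nontrivial
  rcases eq_or_ne g 0 with hg | hg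
  · exact ⟨1, one_pos, Eventually.of_forall fun r Λ hF => (hF.ne_zero hA hg).elim⟩
  have hδ0 := hδ.1
  have hpos := hπ.formalDegree_pos
  obtain ⟨c, hc, hann⟩ := hδ.exists_eventually_measureReal_oball_le hd hα
  obtain ⟨ρ, hρ, hρn⟩ := hd.exists_oball_mem_nhds
  obtain ⟨C, hC, hcard⟩ := hπ.exists_le_card_of_isFrame hd hg (isAdmissibleNhd_interior hQ)
    isOpen_interior hα.le (localizedVectors_anti π _ interior_subset hgQ) hA B
  refine ⟨c + C, by positivity, ?_⟩
  filter_upwards [hann ρ, eventually_mul_rpow_neg_le_half (η := α * δ / (δ + α)) (by positivity)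
    (c + C), eventually_ge_atTop ρ, eventually_gt_atTop 0] with r hvol hsmall hrρ hr Λ hF
  have hsub := hd.closure_oball_subset hρn r
  have htop := hd.measure_oball_lt_top μ (r + ρ)
  refine le_iInf fun x => ofReal_le_countingRatio (measure_closure_oball_ne_zero hρn hrρ)
    ((measure_mono hsub).trans_lt htop).ne fun S hS => ?_
  set s := r ^ (δ / (δ + α))
  have hs : 0 < s := by positivity
  have hcount := hcard Λ hF x r s hs S fun l hl =>
    hS l (Set.smul_set_mono subset_closure ((hd.mem_smul_oball x l r).2 hl))
  have hvol' := hvol (r + ρ) (s + ρ) (by linarith) (by linarith) le_rfl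
  rw [add_sub_add_right_eq_sub] at hvol'
  rw [rpow_scale_rpow_neg hr.le] at hcount
  rw [add_mul] at hsmall
  refine le_trans ?_ hcount
  rw [mul_assoc, add_mul]
  exact mul_le_mul_of_nonneg_left (one_sub_mul_le_of_mul_one_sub_le
    (measureReal_mono hsub htop.ne) measureReal_nonneg (by positivity) (by positivity)
    (by linarith) hvol') hpos.le

theorem IsDiscreteSeries.exists_countingRatio_le_ofReal (hπ : IsDiscreteSeries π μ)
    (hd : IsPeriodicMetric d) (hδ : AnnularDecay μ d δ) (hQ : IsAdmissibleNhd Q) (hα : 0 < α)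
    (hgQ : g ∈ localizedVectors π μ Q (polyWeight d α)) (hA : 0 < A) :
    ∃ C : ℝ, 0 < C ∧ ∀ᶠ r in atTop, ∀ (B : ℝ) (Λ : Set G), IsRieszSequence π g Λ A B →
      ⨆ x : G, countingRatio μ Λ (closure (oball d r)) x
        ≤ ENNReal.ofReal (formalDegree π μ * (1 + C * r ^ (-(α * δ / (δ + α))))) := by
  rcases eq_or_ne g 0 with hg | hg
  · refine ⟨1, one_pos, Eventually.of_forall fun r B Λ hR => ?_⟩
    have hΛ : Λ = ∅ := Set.not_nonempty_iff_eq_empty.1 fun hΛ => hR.ne_zero hA hΛ hg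
    simp [hΛ, countingRatio]
  have hδ0 := hδ.1
  have hpos := hπ.formalDegree_pos
  obtain ⟨c, hc, hann⟩ := hδ.exists_eventually_measureReal_oball_le hd hα
  obtain ⟨ρ, hρ, hρn⟩ := hd.exists_oball_mem_nhds
  obtain ⟨C, hC, hcard⟩ :=
    hπ.exists_card_le_of_isRieszSequence hd hg (mem_of_mem_nhds hQ.1) hα.le hgQ hA
  refine ⟨2 * (c + C), by positivity, ?_⟩
  filter_upwards [hann ρ, eventually_mul_rpow_neg_le_half (η := α * δ / (δ + α)) (by positivity)
    (c + C), eventually_gt_atTop 0] with r hvol hsmall hr B Λ hR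
  have hsub := hd.closure_oball_subset hρn r
  have htop : μ (closure (oball d r)) ≠ ⊤ :=
    ((measure_mono hsub).trans_lt (hd.measure_oball_lt_top μ (r + ρ))).ne
  refine iSup_le fun x => countingRatio_le_ofReal htop fun S hS => ?_
  set s := r ^ (δ / (δ + α))
  have hs : 0 < s := by positivity
  have hcount := hcard Λ B hR x (r + ρ) s hs S fun l hl =>
    (hd.mem_smul_oball x l _).1 (Set.smul_set_mono hsub (hS l hl))
  have hvol' := hvol (r + ρ + s) (s + ρ) (by linarith) (by linarith) le_rfl
  rw [show r + ρ + s - (s + ρ) = r by ring] at hvol'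
  rw [rpow_scale_rpow_neg hr.le] at hcount
  rw [add_mul] at hsmall
  rw [mul_assoc 2 (c + C), add_mul c C]
  exact le_one_add_mul_of_mul_one_sub_le (Nat.cast_nonneg _) hpos.le (by positivity)
    (by positivity) hsmall hcount (hvol'.trans (measureReal_mono subset_closure htop))

end Density

section AssociatedRadii

variable {G : Type*} [Group G] [TopologicalSpace G] {d : G → G → ℝ} {r : ℕ → ℝ}

lemma IsAssociatedRadii.tendsto_atTop (hr : IsAssociatedRadii d r) : Tendsto r atTop atTop := by
  obtain ⟨hpos, r₀, hr₀, -, hstep⟩ := hr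
  have hlinear (n : ℕ) : n * r₀ ≤ r n := by
    induction n with
    | zero => simpa using (hpos 0).le
    | succ n ih =>
      push_cast
      linarith [hstep n]
  exact tendsto_atTop_mono hlinear (tendsto_natCast_atTop_atTop.atTop_mul_const hr₀)

lemma IsAssociatedRadii.exists_forall_of_eventually (hr : IsAssociatedRadii d r) {p : ℝ → Prop}
    (hp : ∀ᶠ t in atTop, p t) : ∃ N : ℕ, ∀ n ≥ N, p (r n) :=
  eventually_atTop.1 (hr.tendsto_atTop.eventually hp)

end AssociatedRadii

end CoherentSystem

open CoherentSystem in
theorem theorem4p4_general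
    {G : Type*} [Group G] [TopologicalSpace G] [IsTopologicalGroup G] [LocallyCompactSpace G]
    [MeasurableSpace G] [BorelSpace G] (μ : Measure G) [μ.IsHaarMeasure] [μ.IsInvInvariant]
    {H : Type*} [NormedAddCommGroup H] [InnerProductSpace ℂ H] [CompleteSpace H]
    (π : ProjectiveRep G H) (hπ : IsDiscreteSeries π μ)
    (d : G → G → ℝ) (hd : IsPeriodicMetric d)
    (δ : ℝ) (hδ : AnnularDecay μ d δ)
    (α : ℝ) (hα : 0 < α) (g : H) :
    (∀ D : ℝ, HasPolynomialGrowth μ D → ∀ C₀ β : ℝ, 0 < β →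
      (∀ x : G, ‖coeff π g g x‖ ≤ C₀ * (1 + d x 1) ^ (-((D + α + β) / 2))) →
      ∀ Q : Set G, IsCompact (closure Q) → g ∈ localizedVectors π μ Q (polyWeight d α)) ∧
    ((∃ Q : Set G, IsAdmissibleNhd Q ∧ g ∈ localizedVectors π μ Q (polyWeight d α)) →
      ∀ A B : ℝ, 0 < A → ∃ C : ℝ, 0 < C ∧ ∀ᶠ r in Filter.atTop,
        ∀ Λ : Set G, IsFrame π g Λ A B →
          ENNReal.ofReal (formalDegree π μ * (1 - C * r ^ (-(α * δ / (δ + α)))))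
            ≤ ⨅ x : G, countingRatio μ Λ (closure (oball d r)) x) ∧
    ((∃ Q : Set G, IsAdmissibleNhd Q ∧ g ∈ localizedVectors π μ Q (polyWeight d α)) →
      ∀ A : ℝ, 0 < A → ∃ C : ℝ, 0 < C ∧ ∀ᶠ r in Filter.atTop,
        ∀ (B : ℝ) (Λ : Set G), IsRieszSequence π g Λ A B →
          ⨆ x : G, countingRatio μ Λ (closure (oball d r)) x
            ≤ ENNReal.ofReal (formalDegree π μ * (1 + C * r ^ (-(α * δ / (δ + α)))))) :=
  ⟨fun _ hG _ _ hβ h _ hQ => mem_localizedVectors_of_decay hG hd π hα hβ h hQ,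
    fun ⟨_, hQ, hgQ⟩ _ B hA => hπ.exists_ofReal_le_countingRatio hd hδ hQ hα hgQ hA B,
    fun ⟨_, hQ, hgQ⟩ _ hA => hπ.exists_countingRatio_le_ofReal hd hδ hQ hα hgQ hA⟩

open CoherentSystem in
theorem theorem4p4
    {G : Type*} [Group G] [TopologicalSpace G] [IsTopologicalGroup G] [T2Space G]
    [LocallyCompactSpace G] [SecondCountableTopology G] [MeasurableSpace G] [BorelSpace G]
    (μ : Measure G) [μ.IsHaarMeasure] [μ.IsMulRightInvariant]
    {H : Type*} [NormedAddCommGroup H] [InnerProductSpace ℂ H] [CompleteSpace H]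
    [TopologicalSpace.SeparableSpace H]
    (π : ProjectiveRep G H) (hπ : IsDiscreteSeries π μ)
    (D : ℝ) (hG : HasPolynomialGrowth μ D)
    (d : G → G → ℝ) (hd : IsPeriodicMetric d)
    (δ : ℝ) (hδ : AnnularDecay μ d δ)
    (α : ℝ) (hα : 0 < α) (g : H) :
    -- polynomial decay of the matrix coefficient implies `g ∈ 𝓓_{π,w_α}`
    (∀ C₀ β : ℝ, 0 < C₀ → 1 - δ < β →
      (∀ x : G, ‖coeff π g g x‖ ≤ C₀ * (1 + d x 1) ^ (-((D + α + β) / 2))) →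
      ∀ Q : Set G, IsAdmissibleNhd Q → g ∈ localizedVectors π μ Q (polyWeight d α)) ∧
    -- frames
    ((∃ Q : Set G, IsAdmissibleNhd Q ∧ g ∈ localizedVectors π μ Q (polyWeight d α)) →
      ∀ A B : ℝ, 0 < A → 0 < B → ∃ C : ℝ, 0 < C ∧
        ∀ r : ℕ → ℝ, IsAssociatedRadii d r → ∃ N : ℕ,
          ∀ Λ : Set G, IsFrame π g Λ A B → ∀ n ≥ N,
            ENNReal.ofReal (formalDegree π μ * (1 - C * r n ^ (-(α * δ / (δ + α)))))
              ≤ ⨅ x : G, countingRatio μ Λ (closure (oball d (r n))) x) ∧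
    -- Riesz sequences
    ((∃ Q : Set G, IsAdmissibleNhd Q ∧ g ∈ localizedVectors π μ Q (polyWeight d α)) →
      ∀ A B : ℝ, 0 < A → 0 < B → ∃ C : ℝ, 0 < C ∧
        ∀ r : ℕ → ℝ, IsAssociatedRadii d r → ∃ N : ℕ,
          ∀ Λ : Set G, IsRieszSequence π g Λ A B → ∀ n ≥ N,
            ⨆ x : G, countingRatio μ Λ (closure (oball d (r n))) x
              ≤ ENNReal.ofReal (formalDegree π μ * (1 + C * r n ^ (-(α * δ / (δ + α)))))) := by
  have := isInvInvariant_of_unimodular μ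
  obtain ⟨hdecay, hframe, hriesz⟩ := theorem4p4_general μ π hπ d hd δ hδ α hα g
  exact ⟨fun C₀ β _ hβ h Q hQ => hdecay D hG C₀ β (by linarith [hδ.2.1]) h Q hQ.2.1,
    fun hg A B hA _ => (hframe hg A B hA).imp fun _ ⟨hC, h⟩ => ⟨hC, fun _ hr =>
      (hr.exists_forall_of_eventually h).imp fun _ hN Λ hΛ n hn => hN n hn Λ hΛ⟩,
    fun hg A B hA _ => (hriesz hg A hA).imp fun _ ⟨hC, h⟩ => ⟨hC, fun _ hr =>
      (hr.exists_forall_of_eventually h).imp fun _ hN Λ hΛ n hn => hN n hn B Λ hΛ⟩⟩
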